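/- **Setting.** Let $\Omega\subset\mathbb R^d$ be nonempty, closed and convex, and let $F(\theta)=\mathbb E_{\xi\sim P}f(\theta,\xi)$, where $f(\cdot,\xi)$ and $F$ are differentiable; write $G(\theta,\xi)=\nabla_\theta f(\theta,\xi)$. For $\gamma>0$ let $\psi(x,w,\gamma)=\arg\min_{\theta\in\Omega}\langle w,\theta\rangle+\frac1{2\gamma}\|\theta-x\|^2$ and let $g(\theta,w,\gamma)=\frac1\gamma(\theta-\psi(\theta,w,\gamma))$ be the gradient mapping. Assume that for some $L>0$ and real $l,\sigma,M$: - $\|\nabla F(x)-\nabla F(y)\|\le L\|x-y\|$ and $-\frac l2\|x-y\|^2\le F(x)-F(y)-\langle\nabla F(y),x-y\rangle$ for all $x,y\in\Omega$; - $\|\psi(x,w,\gamma)\|\le M$ for all $x\in\Omega$, $w\in\mathbb R^d$, $\gamma>0$; - $\mathbb E\,G(\theta,\xi)=\nabla F(\theta)$ and $\mathbb E\|G(\theta,\xi)-\nabla F(\theta)\|^2\le\sigma^2$ for all $\theta\in\Omega$. A stochastic first-order oracle call returns $G(\theta,\xi)$ at a given $\theta$ for a fresh sample $\xi\sim P$.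 A linear-oracle call returns, for a given vector $h$, a minimizer of $\langle\theta,h\rangle$ over $\theta\in\Omega$ (a fixed measurable choice). **Procedure** $\mathrm{condg}(a,u,\gamma,\eta)$. Start at $u_1=u$. For $t=1,2,\dots$: use one linear-oracle call to obtain a maximizer $v_t$ of $x\mapsto\langle a+\frac1\gamma(u_t-u),u_t-x\rangle$ over $\Omega$; if the maximal value is at most $\eta$, return $u_t$; otherwise set $u_{t+1}=(1-s_t)u_t+s_tv_t$ with $s_t=\min\Big\{1,\frac{\langle\frac1\gamma(u-u_t)-a,\,v_t-u_t\rangle}{\frac1\gamma\|v_t-u_t\|^2}\Big\}$. **Stochastic NCGS.** Given $N\ge1$ and $\theta_0=\theta_0^{ag}\in\Omega$, put $\alpha_k=\frac2{k+1}$, $\beta_k=\frac1{2L}$, $\lambda_k=\frac{k\beta_k}2$, $\eta_k=\chi_k=\frac1N$, $m_k=k$, $\Gamma_k=\frac2{k(k+1)}$. Draw $R\in\{1,\dots,N\}$ with $\Pr\{R=k\}=\Gamma_k^{-1}/\sum_{j=1}^N\Gamma_j^{-1}$, independently of the i.i.d. samples $\xi_{k,i}\sim P$. For $k=1,\dots,R$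 set $$\theta_k^{md}=(1-\alpha_k)\theta_{k-1}^{ag}+\alpha_k\theta_{k-1},\qquad \bar G_k=\frac1{m_k}\sum_{i=1}^{m_k}G(\theta_k^{md},\xi_{k,i}),$$ $$\theta_k=\mathrm{condg}(\bar G_k,\theta_{k-1},\lambda_k,\eta_k),\qquad \theta_k^{ag}=\mathrm{condg}(\bar G_k,\theta_k^{md},\beta_k,\chi_k).$$ **Claim.** There is a constant $C>0$ depending only on $L,l,\sigma,M$ such that for every $\varepsilon\in(0,1]$ there is $N\ge1$, depending only on $\varepsilon,L,l,\sigma,M$, for which stochastic NCGS run with this $N$, on any problem as above and from any $\theta_0\in\Omega$, satisfies $$\mathbb E\|g(\theta_R^{md},\bar G_R,\beta_R)\|^2\le\varepsilon\quad\text{and}\quad \mathbb E\|g(\theta_R^{md},\nabla F(\theta_R^{md}),\beta_R)\|^2\le\varepsilon,$$ and almost surely the whole run terminates and makes at most $C/\varepsilon^2$ stochastic first-order oracle calls and at most $C/\varepsilon^2$ linear-oracle calls. -/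

import Mathlib

open MeasureTheory ProbabilityTheory

noncomputable section

namespace NCGS

/-- Euclidean space of dimension `d`. -/
abbrev Vec (d : ℕ) := EuclideanSpace ℝ (Fin d)

/-! ### Prox-mapping and gradient mapping -/

/-- `y` is a minimizer over `K` of `⟨w, θ⟩ + ‖θ - x‖² / (2γ)`. -/
def IsProxPoint {d : ℕ} (K : Set (Vec d)) (x w : Vec d) (γ : ℝ) (y : Vec d) : Prop :=
  y ∈ K ∧ ∀ θ ∈ K, inner ℝ w y + 1 / (2 * γ) * ‖y - x‖ ^ 2
    ≤ inner ℝ w θ + 1 / (2 * γ) * ‖θ - x‖ ^ 2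

/-- The prox-mapping `ψ(x, w, γ) = argmin_{θ ∈ K} ⟨w, θ⟩ + ‖θ - x‖² / (2γ)`. The minimizer exists
and is unique when `K` is nonempty, closed and convex and `0 < γ`. -/
def prox {d : ℕ} (K : Set (Vec d)) (x w : Vec d) (γ : ℝ) : Vec d :=
  Classical.epsilon (IsProxPoint K x w γ)

/-- The gradient mapping `g(θ, w, γ) = (θ - ψ(θ, w, γ)) / γ`. -/
def gradMap {d : ℕ} (K : Set (Vec d)) (θ w : Vec d) (γ : ℝ) : Vec d :=
  (1 / γ) • (θ - prox K θ w γ)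

/-! ### The optimization problem and its assumptions -/

/-- `‖∇F(x) - ∇F(y)‖ ≤ L ‖x - y‖` on `K`. -/
def LSmoothOn {d : ℕ} (L : ℝ) (K : Set (Vec d)) (F : Vec d → ℝ) : Prop :=
  ∀ x ∈ K, ∀ y ∈ K, ‖gradient F x - gradient F y‖ ≤ L * ‖x - y‖

/-- `-(l/2) ‖x - y‖² ≤ F(x) - F(y) - ⟨∇F(y), x - y⟩` on `K`. -/
def LowerSmoothOn {d : ℕ} (l : ℝ) (K : Set (Vec d)) (F : Vec d → ℝ) : Prop :=
  ∀ x ∈ K, ∀ y ∈ K, -(l / 2) * ‖x - y‖ ^ 2 ≤ F x - F y - inner ℝ (gradient F y) (x - y)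

/-- The objective `F(θ) = E_ξ f(θ, ξ)`, `ξ ∼ P`. -/
def objective {d : ℕ} {Ξ : Type*} [MeasurableSpace Ξ] (P : Measure Ξ) (f : Vec d → Ξ → ℝ) :
    Vec d → ℝ := fun θ => ∫ z, f θ z ∂P

/-- The stochastic gradient `G(θ, ξ) = ∇_θ f(θ, ξ)`. -/
def stochGrad {d : ℕ} {Ξ : Type*} (f : Vec d → Ξ → ℝ) (θ : Vec d) (z : Ξ) : Vec d :=
  gradient (fun x => f x z) θ

/-- The standing assumptions on the problem `min_{θ ∈ K} F(θ) = E_ξ f(θ, ξ)`. -/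
structure IsStochasticProblem {d : ℕ} {Ξ : Type*} [MeasurableSpace Ξ] (L l σ M : ℝ)
    (K : Set (Vec d)) (P : Measure Ξ) (f : Vec d → Ξ → ℝ) : Prop where
  nonempty : K.Nonempty
  isClosed : IsClosed K
  convex : Convex ℝ K
  prox_bound : ∀ x ∈ K, ∀ w : Vec d, ∀ γ : ℝ, 0 < γ → ‖prox K x w γ‖ ≤ M
  integrable : ∀ θ, Integrable (f θ) P
  differentiable_f : ∀ z, Differentiable ℝ (fun θ => f θ z)
  measurable_grad : Measurable (fun q : Vec d × Ξ => stochGrad f q.1 q.2)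
  differentiable : Differentiable ℝ (objective P f)
  smooth : LSmoothOn L K (objective P f)
  lower_smooth : LowerSmoothOn l K (objective P f)
  integrable_grad : ∀ θ ∈ K, Integrable (stochGrad f θ) P
  unbiased : ∀ θ ∈ K, ∫ z, stochGrad f θ z ∂P = gradient (objective P f) θ
  variance : ∀ θ ∈ K,
    ∫⁻ z, ‖stochGrad f θ z - gradient (objective P f) θ‖ₑ ^ 2 ∂P ≤ ENNReal.ofReal (σ ^ 2)

/-- A linear oracle: for each query `g` it returns a minimizer of `⟨θ, g⟩` over `K`. -/
structure IsLinearOracle {d : ℕ} (K : Set (Vec d)) (lo : Vec d → Vec d) : Prop where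
  measurable : Measurable lo
  mem : ∀ g, lo g ∈ K
  le : ∀ g, ∀ θ ∈ K, inner ℝ (lo g) g ≤ inner ℝ θ g

/-! ### The procedure `condg` -/

/-- The oracle's answer at the current point `w` of the procedure: a maximizer over `x` of
`⟨a + (w - u) / γ, w - x⟩`. -/
def condgVertex {d : ℕ} (lo : Vec d → Vec d) (a u : Vec d) (γ : ℝ) (w : Vec d) : Vec d :=
  lo (a + (1 / γ) • (w - u))

/-- The value `V(w) = max_x ⟨a + (w - u) / γ, w - x⟩`, computed from the oracle's answer. -/
def condgGap {d : ℕ} (lo : Vec d → Vec d) (a u : Vec d) (γ : ℝ) (w : Vec d) : ℝ :=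
  inner ℝ (a + (1 / γ) • (w - u)) (w - condgVertex lo a u γ w)

/-- The step size of the procedure at the current point `w`. -/
def condgStepSize {d : ℕ} (lo : Vec d → Vec d) (a u : Vec d) (γ : ℝ) (w : Vec d) : ℝ :=
  min 1 (inner ℝ ((1 / γ) • (u - w) - a) (condgVertex lo a u γ w - w)
    / ((1 / γ) * ‖condgVertex lo a u γ w - w‖ ^ 2))

/-- One update of the procedure. -/
def condgStep {d : ℕ} (lo : Vec d → Vec d) (a u : Vec d) (γ : ℝ) (w : Vec d) : Vec d :=
  (1 - condgStepSize lo a u γ w) • w + condgStepSize lo a u γ w • condgVertex lo a u γ w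

/-- The points generated by the procedure, numbered from `0` (where the point is `u`). -/
def condgIter {d : ℕ} (lo : Vec d → Vec d) (a u : Vec d) (γ : ℝ) (t : ℕ) : Vec d :=
  (condgStep lo a u γ)^[t] u

/-- The times at which the stopping test `V(u_t) ≤ η` succeeds. -/
def condgStops {d : ℕ} (lo : Vec d → Vec d) (a u : Vec d) (γ η : ℝ) : Set ℕ :=
  {t | condgGap lo a u γ (condgIter lo a u γ t) ≤ η}

/-- The result `condg(a, u, γ, η)`: the first point at which the stopping test succeeds. -/
def condg {d : ℕ} (lo : Vec d → Vec d) (a u : Vec d) (γ η : ℝ) : Vec d :=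
  condgIter lo a u γ (sInf (condgStops lo a u γ η))

/-- The number of linear-oracle calls made by `condg(a, u, γ, η)`: one at each visited point,
including the last one. It is `⊤` if the procedure does not terminate. -/
def condgCalls {d : ℕ} (lo : Vec d → Vec d) (a u : Vec d) (γ η : ℝ) : ℕ∞ :=
  ⨅ t ∈ condgStops lo a u γ η, ((t + 1 : ℕ) : ℕ∞)

/-! ### The stochastic method -/

/-- Parameter sequences of the method (used at `k = 1, 2, …`). -/
structure Params where
  α : ℕ → ℝ
  β : ℕ → ℝ
  lam : ℕ → ℝ
  η : ℕ → ℝ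
  χ : ℕ → ℝ
  m : ℕ → ℕ

/-- `α_k = 2/(k+1)`, `β_k = 1/(2L)`, `λ_k = k β_k / 2`, `η_k = χ_k = 1/N`, `m_k = k`. -/
def stdParams (L : ℝ) (N : ℕ) : Params where
  α k := 2 / ((k : ℝ) + 1)
  β _ := 1 / (2 * L)
  lam k := (k : ℝ) * (1 / (2 * L)) / 2
  η _ := 1 / (N : ℝ)
  χ _ := 1 / (N : ℝ)
  m k := k

/-- `Γ_k = 2 / (k (k+1))`. -/
def Gam (k : ℕ) : ℝ := 2 / ((k : ℝ) * ((k : ℝ) + 1))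

/-- `p_k = Γ_k⁻¹ / ∑_{j=1}^N Γ_j⁻¹`. -/
def stopProb (N k : ℕ) : ℝ := (Gam k)⁻¹ / ∑ j ∈ Finset.Icc 1 N, (Gam j)⁻¹

/-- The state after an iteration: `θ_k`, `θ_k^{ag}`, and the numbers of stochastic first-order and
linear oracle calls made so far. -/
structure State (d : ℕ) where
  θ : Vec d
  ag : Vec d
  sfo : ℕ
  lo : ℕ∞

/-- `θ_k^{md} = (1 - α_k) θ_{k-1}^{ag} + α_k θ_{k-1}`, from the state after iteration `k - 1`. -/
def mdOf {d : ℕ} (p : Params) (k : ℕ) (st : State d) : Vec d :=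
  (1 - p.α k) • st.ag + p.α k • st.θ

/-- The mini-batch average `(1/m_k) ∑_{i=1}^{m_k} G(x, ξ_{k,i})`, where `s (k, i) = ξ_{k,i}`. -/
def miniBatch {d : ℕ} {Ξ : Type*} (p : Params) (G : Vec d → Ξ → Vec d) (s : ℕ × ℕ → Ξ)
    (k : ℕ) (x : Vec d) : Vec d :=
  (1 / (p.m k : ℝ)) • ∑ i ∈ Finset.Icc 1 (p.m k), G x (s (k, i))

/-- Iteration `k` of the method. -/
def stepState {d : ℕ} {Ξ : Type*} (p : Params) (G : Vec d → Ξ → Vec d) (lo : Vec d → Vec d)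
    (s : ℕ × ℕ → Ξ) (k : ℕ) (st : State d) : State d where
  θ := condg lo (miniBatch p G s k (mdOf p k st)) st.θ (p.lam k) (p.η k)
  ag := condg lo (miniBatch p G s k (mdOf p k st)) (mdOf p k st) (p.β k) (p.χ k)
  sfo := st.sfo + p.m k
  lo := st.lo
    + condgCalls lo (miniBatch p G s k (mdOf p k st)) st.θ (p.lam k) (p.η k)
    + condgCalls lo (miniBatch p G s k (mdOf p k st)) (mdOf p k st) (p.β k) (p.χ k)

/-- The state after the iterations `1, …, k`, started at `θ₀ = θ₀^{ag}`, with samples `s`. -/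
def run {d : ℕ} {Ξ : Type*} (p : Params) (G : Vec d → Ξ → Vec d) (lo : Vec d → Vec d)
    (θ₀ : Vec d) (s : ℕ × ℕ → Ξ) : ℕ → State d
  | 0 => ⟨θ₀, θ₀, 0, 0⟩
  | k + 1 => stepState p G lo s (k + 1) (run p G lo θ₀ s k)

/-- The point `θ_k^{md}` of the run (`k ≥ 1`). -/
def mdPoint {d : ℕ} {Ξ : Type*} (p : Params) (G : Vec d → Ξ → Vec d) (lo : Vec d → Vec d)
    (θ₀ : Vec d) (s : ℕ × ℕ → Ξ) (k : ℕ) : Vec d :=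
  mdOf p k (run p G lo θ₀ s (k - 1))

/-- The averaged stochastic gradient `Ḡ_k` of the run (`k ≥ 1`). -/
def avgGrad {d : ℕ} {Ξ : Type*} (p : Params) (G : Vec d → Ξ → Vec d) (lo : Vec d → Vec d)
    (θ₀ : Vec d) (s : ℕ × ℕ → Ξ) (k : ℕ) : Vec d :=
  miniBatch p G s k (mdPoint p G lo θ₀ s k)

/-- The randomness of the method: i.i.d. samples `ξ_{k,i} ∼ P`, and an independent random index `R`
with `Prob{R = k} = p_k` for `k = 1, …, N`. -/
structure IsSampling {Ξ W : Type*} [MeasurableSpace Ξ] [MeasurableSpace W] (P : Measure Ξ)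
    (μ : Measure W) (ξ : ℕ × ℕ → W → Ξ) (N : ℕ) (R : W → ℕ) : Prop where
  measurable_sample : ∀ j, Measurable (ξ j)
  law_sample : ∀ j, μ.map (ξ j) = P
  indep_sample : iIndepFun ξ μ
  measurable_index : Measurable R
  law_index : ∀ k ∈ Finset.Icc 1 N, μ {ω | R ω = k} = ENNReal.ofReal (stopProb N k)
  indep_index : IndepFun R (fun ω j => ξ j ω) μ

end NCGS

end

/-! The method is analysed as accelerated gradient descent with inexact prox steps, each computed by
conditional gradient.

Since `ψ(x, 0, γ) = x`, the bound on the prox-mapping bounds the feasible set itself (`prox_zero`):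
it is compact, with squared diameter at most `D = 4 M ^ 2`. All constants enter through `L`, `l`,
`σ` and `D`.

`condg` is the Frank-Wolfe method with exact line search on the quadratic `⟨a, x⟩ + ‖x - u‖² /
(2γ)`. Its stopping test is the variational inequality of the prox point with error `η`
(`isApproxProx_condg`), and it succeeds after `O(D / (γ η))` steps, up to the harmless additive
constant in the curvature bound (`exists_mem_condgStops`). As `1 / β_k` and `1 / λ_k` are at most `4
L` and `η_k = χ_k = 1 / N`, each call costs `O(N)` oracle calls, and a run of at most `N` iterations
costs `O(N ^ 2)`.

In one iteration (`one_iteration_le`), the descent lemma and the two approximate prox inequalities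
give a contraction of `F(ag) - F(x)` by `1 - α_k`, a gain `L / 4 * ‖ag - md‖ ^ 2`, a difference of
squared distances to `x`, and errors from inexactness, from nonconvexity (`|l| α_k D`) and from
gradient noise. Young's inequality bounds the noise, so only its second moment is needed, and no
martingale argument. With weights `1 / Γ_k = k (k + 1) / 2` the function values and the distances
both telescope, because `(1 - α_k) / Γ_k = 1 / Γ_{k-1}` (with `0` in place of `1 / Γ_0`) and `α_k /
(2 λ_k Γ_k) = 2 L`. Every weighted error is `O(N)` per iteration, the noise because a batch of size
`k` has variance at most `σ ^ 2 / k`. So the weighted gains sum to `O(N ^ 2)`, while the weights sum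
to order `N ^ 3`.

The gradient mapping is controlled by `‖ag - md‖` and the prox error (`norm_gradMap_sq_le`).
Averaging with the law of `R` therefore gives `O(1 / N)`; nonexpansiveness of the prox-mapping
transfers this to the exact gradient. Taking `N` of order `1 / ε` yields both accuracy bounds and
both `O(1 / ε ^ 2)` complexity bounds. -/

noncomputable section

namespace NCGS

variable {d : ℕ}

/-! ### The prox-mapping -/

/-- The variational inequality for the prox-mapping, with an error `e`. -/
def IsApproxProx (K : Set (Vec d)) (x w : Vec d) (γ e : ℝ) (y : Vec d) : Prop :=
  y ∈ K ∧ ∀ θ ∈ K, inner ℝ (w + (1 / γ) • (y - x)) (y - θ) ≤ e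

/-- Divide by `t` and let `t` tend to `0`: this is the first-order optimality condition along a
segment. -/
theorem nonneg_of_forall_linear_add_quadratic {A B : ℝ}
    (h : ∀ t : ℝ, 0 < t → t ≤ 1 → 0 ≤ t * A + t ^ 2 * B) : 0 ≤ A := by
  by_contra hA
  push Not at hA
  by_cases hB : B ≤ 0
  · have := h 1 one_pos le_rfl
    linarith
  push Not at hB
  -- At this `t` the quadratic term cancels at most half of the negative linear term.
  have ht : 0 < min 1 (-A / (2 * B)) := lt_min one_pos (div_pos (by linarith) (by linarith))
  have h1 := h _ ht (min_le_left _ _)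
  have h2 : min 1 (-A / (2 * B)) * B ≤ -A / 2 := by
    calc min 1 (-A / (2 * B)) * B ≤ -A / (2 * B) * B := by gcongr; exact min_le_right _ _
      _ = -A / 2 := by field_simp
  nlinarith

theorem IsProxPoint.isApproxProx {K : Set (Vec d)} (hK : Convex ℝ K) {x w y : Vec d} {γ : ℝ}
    (h : IsProxPoint K x w γ y) : IsApproxProx K x w γ 0 y := by
  refine ⟨h.1, fun θ hθ => ?_⟩
  have key : 0 ≤ inner ℝ (w + (1 / γ) • (y - x)) (θ - y) := by
    refine nonneg_of_forall_linear_add_quadratic (B := 1 / (2 * γ) * ‖θ - y‖ ^ 2)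
      fun t ht ht1 => ?_
    have hz : y + t • (θ - y) ∈ K := hK.add_smul_sub_mem h.1 hθ ⟨ht.le, ht1⟩
    have h2 := h.2 _ hz
    have e : y + t • (θ - y) - x = (y - x) + t • (θ - y) := by abel
    rw [e, norm_add_sq_real, inner_add_right, inner_smul_right, inner_smul_right, norm_smul,
      mul_pow, Real.norm_eq_abs, sq_abs] at h2
    rw [inner_add_left, inner_smul_left]
    simp only [conj_trivial]
    have e2 : 1 / γ = 2 * (1 / (2 * γ)) := by
      rw [one_div, one_div, mul_inv]; ring
    rw [e2]
    linarith
  rw [← neg_sub θ y, inner_neg_right]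
  linarith

/-- Approximate prox points are stable in the data. -/
theorem IsApproxProx.norm_sub_sq_le {K : Set (Vec d)} {x x' w w' y y' : Vec d} {γ e e' : ℝ}
    (hγ : 0 < γ) (h : IsApproxProx K x w γ e y) (h' : IsApproxProx K x' w' γ e' y') :
    ‖y - y'‖ ^ 2 ≤ inner ℝ ((x - γ • w) - (x' - γ • w')) (y - y') + γ * (e + e') := by
  -- Each variational inequality is tested at the other's point; adding them exposes the strong
  -- monotonicity of the quadratic part.
  have h1 := h.2 y' h'.1
  have h2 := h'.2 y h.1
  have e1 : γ * inner ℝ (w + (1 / γ) • (y - x)) (y - y')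
      = inner ℝ (γ • w + (y - x)) (y - y') := by
    rw [← real_inner_smul_left, smul_add, smul_smul, mul_one_div_cancel hγ.ne', one_smul]
  have e2 : γ * inner ℝ (w' + (1 / γ) • (y' - x')) (y' - y)
      = inner ℝ (γ • w' + (y' - x')) (y' - y) := by
    rw [← real_inner_smul_left, smul_add, smul_smul, mul_one_div_cancel hγ.ne', one_smul]
  have h3 := mul_le_mul_of_nonneg_left h1 hγ.le
  have h4 := mul_le_mul_of_nonneg_left h2 hγ.le
  rw [e1] at h3
  rw [e2] at h4
  have e3 : ‖y - y'‖ ^ 2 = inner ℝ (γ • w + (y - x)) (y - y') +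
      inner ℝ (γ • w' + (y' - x')) (y' - y) +
      inner ℝ ((x - γ • w) - (x' - γ • w')) (y - y') := by
    rw [← neg_sub y y', inner_neg_right, ← sub_eq_add_neg, ← inner_sub_left, ← inner_add_left,
      ← real_inner_self_eq_norm_sq]
    congr 1
    abel
  linarith

theorem IsApproxProx.norm_sub_le {K : Set (Vec d)} {x x' w w' y y' : Vec d} {γ : ℝ}
    (hγ : 0 < γ) (h : IsApproxProx K x w γ 0 y) (h' : IsApproxProx K x' w' γ 0 y') :
    ‖y - y'‖ ≤ ‖(x - γ • w) - (x' - γ • w')‖ := by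
  have h1 := h.norm_sub_sq_le hγ h'
  have h2 := real_inner_le_norm ((x - γ • w) - (x' - γ • w')) (y - y')
  by_contra! hlt
  nlinarith [norm_nonneg (y - y'), norm_nonneg ((x - γ • w) - (x' - γ • w'))]

theorem exists_isProxPoint {K : Set (Vec d)} (hne : K.Nonempty) (hK : IsCompact K)
    (x w : Vec d) (γ : ℝ) : ∃ y, IsProxPoint K x w γ y := by
  obtain ⟨y, hy, hmin⟩ := hK.exists_isMinOn hne
    (f := fun θ : Vec d => inner ℝ w θ + 1 / (2 * γ) * ‖θ - x‖ ^ 2)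
    (Continuous.continuousOn (by fun_prop))
  exact ⟨y, hy, fun θ hθ => hmin hθ⟩

theorem isProxPoint_prox {K : Set (Vec d)} (hne : K.Nonempty) (hK : IsCompact K)
    (x w : Vec d) (γ : ℝ) : IsProxPoint K x w γ (prox K x w γ) :=
  Classical.epsilon_spec (exists_isProxPoint hne hK x w γ)

theorem isApproxProx_prox {K : Set (Vec d)} (hne : K.Nonempty) (hK : IsCompact K)
    (hconv : Convex ℝ K) (x w : Vec d) (γ : ℝ) : IsApproxProx K x w γ 0 (prox K x w γ) :=
  (isProxPoint_prox hne hK x w γ).isApproxProx hconv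

/-- The minimizer is exhibited directly, so compactness is not needed; compactness will be deduced
from this fact. -/
theorem prox_zero {K : Set (Vec d)} {x : Vec d} (hx : x ∈ K) {γ : ℝ} (hγ : 0 < γ) :
    prox K x 0 γ = x := by
  have hex : IsProxPoint K x 0 γ x := by
    refine ⟨hx, fun θ _ => ?_⟩
    simp only [inner_zero_left, sub_self, norm_zero]
    have : 0 ≤ 1 / (2 * γ) * ‖θ - x‖ ^ 2 := by positivity
    simpa using this
  have h : IsProxPoint K x 0 γ (prox K x 0 γ) := Classical.epsilon_spec ⟨x, hex⟩
  have h1 := h.2 x hx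
  simp only [inner_zero_left, sub_self, norm_zero, zero_add] at h1
  have h2 : 0 < 1 / (2 * γ) := by positivity
  have h3 : ‖prox K x 0 γ - x‖ ^ 2 ≤ 0 := by
    by_contra! hlt
    have := mul_pos h2 hlt
    simp at h1
    simp at this
    linarith
  have h4 : ‖prox K x 0 γ - x‖ = 0 := by
    nlinarith [norm_nonneg (prox K x 0 γ - x)]
  rwa [norm_sub_eq_zero_iff] at h4

theorem norm_prox_sub_prox_le {K : Set (Vec d)} (hne : K.Nonempty) (hK : IsCompact K)
    (hconv : Convex ℝ K) {γ : ℝ} (hγ : 0 < γ) (x x' w w' : Vec d) :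
    ‖prox K x w γ - prox K x' w' γ‖ ≤ ‖(x - γ • w) - (x' - γ • w')‖ :=
  (isApproxProx_prox hne hK hconv x w γ).norm_sub_le hγ (isApproxProx_prox hne hK hconv x' w' γ)

/-- The prox-mapping is defined by a choice operator; this continuity is what makes gradient
mappings of random points measurable. -/
theorem continuous_prox {K : Set (Vec d)} (hne : K.Nonempty) (hK : IsCompact K)
    (hconv : Convex ℝ K) {γ : ℝ} (hγ : 0 < γ) :
    Continuous (fun q : Vec d × Vec d => prox K q.1 q.2 γ) := by
  rw [continuous_iff_continuousAt]
  intro q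
  have hc : Filter.Tendsto
      (fun q' : Vec d × Vec d => ‖(q'.1 - γ • q'.2) - (q.1 - γ • q.2)‖) (nhds q) (nhds 0) := by
    have : Continuous
        (fun q' : Vec d × Vec d => ‖(q'.1 - γ • q'.2) - (q.1 - γ • q.2)‖) := by fun_prop
    simpa using this.tendsto q
  exact tendsto_iff_norm_sub_tendsto_zero.2 (squeeze_zero (fun _ => norm_nonneg _)
    (fun q' => norm_prox_sub_prox_le hne hK hconv hγ _ _ _ _) hc)

theorem continuous_gradMap {K : Set (Vec d)} (hne : K.Nonempty) (hK : IsCompact K)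
    (hconv : Convex ℝ K) {γ : ℝ} (hγ : 0 < γ) :
    Continuous (fun q : Vec d × Vec d => gradMap K q.1 q.2 γ) := by
  have := continuous_prox hne hK hconv hγ
  unfold gradMap
  fun_prop

theorem norm_gradMap_sub_le {K : Set (Vec d)} (hne : K.Nonempty) (hK : IsCompact K)
    (hconv : Convex ℝ K) {γ : ℝ} (hγ : 0 < γ) (x w w' : Vec d) :
    ‖gradMap K x w γ - gradMap K x w' γ‖ ≤ ‖w - w'‖ := by
  have h := norm_prox_sub_prox_le hne hK hconv hγ x x w w'
  have e1 : gradMap K x w γ - gradMap K x w' γ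
      = (1 / γ) • -(prox K x w γ - prox K x w' γ) := by
    unfold gradMap; rw [← smul_sub]; congr 1; abel
  have e2 : (x - γ • w) - (x - γ • w') = γ • -(w - w') := by
    rw [smul_neg, smul_sub]; abel
  rw [e2, norm_smul, norm_neg, Real.norm_eq_abs, abs_of_pos hγ] at h
  rw [e1, norm_smul, norm_neg, Real.norm_eq_abs, abs_of_pos (by positivity), one_div,
    inv_mul_le_iff₀ hγ]
  exact h

/-- An `e`-approximate prox point lies within squared distance `γ * e` of the exact one, so the
computed displacement `y - x` can replace the exact one. -/
theorem norm_gradMap_sq_le {K : Set (Vec d)} (hne : K.Nonempty) (hK : IsCompact K)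
    (hconv : Convex ℝ K) {γ e : ℝ} (hγ : 0 < γ) {x w y : Vec d}
    (h : IsApproxProx K x w γ e y) :
    ‖gradMap K x w γ‖ ^ 2 ≤ 2 / γ ^ 2 * ‖y - x‖ ^ 2 + 2 / γ * e := by
  have h1 := h.norm_sub_sq_le hγ (isApproxProx_prox hne hK hconv x w γ)
  rw [sub_self, inner_zero_left] at h1
  have h2 : ‖x - prox K x w γ‖ ^ 2 ≤ 2 * ‖y - x‖ ^ 2 + 2 * ‖y - prox K x w γ‖ ^ 2 := by
    have e1 : x - prox K x w γ = (y - prox K x w γ) - (y - x) := by abel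
    have := parallelogram_law_with_norm ℝ (y - prox K x w γ) (y - x)
    rw [e1]
    nlinarith [norm_nonneg (y - prox K x w γ + (y - x))]
  have h3 : ‖gradMap K x w γ‖ ^ 2 = 1 / γ ^ 2 * ‖x - prox K x w γ‖ ^ 2 := by
    unfold gradMap
    rw [norm_smul, mul_pow, Real.norm_eq_abs, sq_abs, div_pow, one_pow]
  rw [h3]
  calc 1 / γ ^ 2 * ‖x - prox K x w γ‖ ^ 2
      ≤ 1 / γ ^ 2 * (2 * ‖y - x‖ ^ 2 + 2 * (γ * e)) := by gcongr; linarith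
    _ = 2 / γ ^ 2 * ‖y - x‖ ^ 2 + 2 / γ * e := by field_simp

section

/-! ### Complexity of the procedure `condg` -/

/-- The objective `⟨a, x⟩ + ‖x - u‖² / (2γ)` which `condg(a, u, γ, ·)` minimizes. -/
def condgObj (a u : Vec d) (γ : ℝ) (x : Vec d) : ℝ :=
  inner ℝ a x + 1 / (2 * γ) * ‖x - u‖ ^ 2

theorem condgObj_add_smul (a u : Vec d) (γ : ℝ) (w z : Vec d) (s : ℝ) :
    condgObj a u γ (w + s • z) = condgObj a u γ w + s * inner ℝ (a + (1 / γ) • (w - u)) z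
      + s ^ 2 * (1 / (2 * γ) * ‖z‖ ^ 2) := by
  unfold condgObj
  have e : w + s • z - u = (w - u) + s • z := by abel
  have e2 : 1 / γ = 2 * (1 / (2 * γ)) := by
    rw [one_div, one_div, mul_inv]; ring
  rw [e, norm_add_sq_real, inner_add_right, inner_smul_right, inner_smul_right, norm_smul,
    mul_pow, Real.norm_eq_abs, sq_abs, inner_add_left, real_inner_smul_left, e2]
  ring

variable {K : Set (Vec d)} {lo : Vec d → Vec d} {a u : Vec d} {γ : ℝ}

theorem inner_le_condgGap (hlo : IsLinearOracle K lo) (w : Vec d) {θ : Vec d} (hθ : θ ∈ K) :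
    inner ℝ (a + (1 / γ) • (w - u)) (w - θ) ≤ condgGap lo a u γ w := by
  unfold condgGap condgVertex
  have h := hlo.le (a + (1 / γ) • (w - u)) θ hθ
  rw [inner_sub_right, inner_sub_right]
  rw [real_inner_comm, real_inner_comm _ θ] at h
  linarith

theorem condgGap_nonneg (hlo : IsLinearOracle K lo) {w : Vec d} (hw : w ∈ K) :
    0 ≤ condgGap lo a u γ w := by
  simpa using inner_le_condgGap (a := a) (u := u) (γ := γ) hlo w hw

/-- By convexity the Frank-Wolfe gap dominates the suboptimality relative to any feasible point, not
only relative to a minimizer. -/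
theorem condgObj_sub_le_condgGap (hlo : IsLinearOracle K lo) (hγ : 0 < γ) (w : Vec d)
    {x : Vec d} (hx : x ∈ K) :
    condgObj a u γ w - condgObj a u γ x ≤ condgGap lo a u γ w := by
  have h := inner_le_condgGap (a := a) (u := u) (γ := γ) hlo w hx
  have e := condgObj_add_smul a u γ w (x - w) 1
  rw [one_smul, add_sub_cancel] at e
  rw [← neg_sub x w, inner_neg_right] at h
  have : 0 ≤ 1 / (2 * γ) * ‖x - w‖ ^ 2 := by positivity
  linarith

/-- The clipped vertex of the parabola minimizes it over `s ≤ 1`. If `q = 0`, Lean's `V / 0 = 0`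
gives a zero step, which is harmless since then `V = 0`. -/
theorem min_one_div_minimizes {V q s : ℝ} (hq : 0 ≤ q) (hV : 0 ≤ V) (hqV : q = 0 → V = 0)
    (hs : s ≤ 1) :
    -(min 1 (V / q)) * V + (min 1 (V / q)) ^ 2 * (q / 2) ≤ -s * V + s ^ 2 * (q / 2) := by
  rcases hq.eq_or_lt with h0 | hq
  · simp [hqV h0.symm, ← h0]
  rcases le_total 1 (V / q) with h | h
  · rw [min_eq_left h]
    rw [one_le_div hq] at h
    nlinarith [mul_nonneg (sub_nonneg.2 hs) (sub_nonneg.2 h),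
      mul_nonneg (mul_nonneg (sub_nonneg.2 hs) (sub_nonneg.2 hs)) hq.le]
  · rw [min_eq_right h]
    obtain ⟨r, rfl⟩ : ∃ r, V = r * q := ⟨V / q, by field_simp⟩
    rw [mul_div_cancel_right₀ _ hq.ne']
    nlinarith [mul_nonneg (sq_nonneg (r - s)) hq.le]

theorem condgStep_eq (lo : Vec d → Vec d) (a u : Vec d) (γ : ℝ) (w : Vec d) :
    condgStep lo a u γ w = w + condgStepSize lo a u γ w • (condgVertex lo a u γ w - w) := by
  unfold condgStep
  module

theorem condgStepSize_eq (lo : Vec d → Vec d) (a u : Vec d) (γ : ℝ) (w : Vec d) :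
    condgStepSize lo a u γ w
      = min 1 (condgGap lo a u γ w / ((1 / γ) * ‖condgVertex lo a u γ w - w‖ ^ 2)) := by
  unfold condgStepSize condgGap
  congr 2
  rw [← inner_neg_neg]
  congr 1
  · module
  · abel

theorem condgStep_mem (hK : Convex ℝ K) (hlo : IsLinearOracle K lo) (hγ : 0 < γ) {w : Vec d}
    (hw : w ∈ K) : condgStep lo a u γ w ∈ K := by
  rw [condgStep_eq]
  refine hK.add_smul_sub_mem hw (hlo.mem _) ⟨?_, ?_⟩
  · rw [condgStepSize_eq]
    exact le_min zero_le_one (div_nonneg (condgGap_nonneg hlo hw) (by positivity))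
  · exact min_le_left _ _

/-- Exact line search is at least as good as any step `s ≤ 1`. Leaving `s` free allows a different
comparison step in each phase of the complexity proof. -/
theorem condgObj_condgStep_le (hlo : IsLinearOracle K lo) (hγ : 0 < γ) {B : ℝ}
    (hB : ∀ x ∈ K, ∀ y ∈ K, (1 / γ) * ‖x - y‖ ^ 2 ≤ B) {w : Vec d} (hw : w ∈ K)
    {s : ℝ} (hs : s ≤ 1) :
    condgObj a u γ (condgStep lo a u γ w)
      ≤ condgObj a u γ w - s * condgGap lo a u γ w + s ^ 2 * (B / 2) := by
  set v := condgVertex lo a u γ w with hv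
  set V := condgGap lo a u γ w with hV
  have hvK : v ∈ K := hlo.mem _
  have hq0 : 0 ≤ (1 / γ) * ‖v - w‖ ^ 2 := by positivity
  have hin : inner ℝ (a + (1 / γ) • (w - u)) (v - w) = -V := by
    rw [hV, condgGap, ← inner_neg_right, neg_sub]
  have hmin := min_one_div_minimizes (V := V) (s := s) hq0 (condgGap_nonneg hlo hw)
    (fun h0 => by
      have h1 : ‖v - w‖ ^ 2 = 0 := by
        rcases mul_eq_zero.1 h0 with h | h
        · exact absurd h (by positivity)
        · exact h
      have h2 : v - w = 0 := by simpa using h1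
      rw [h2, inner_zero_right] at hin
      linarith) hs
  rw [condgStep_eq, condgObj_add_smul, condgStepSize_eq, ← hv, hin, ← hV]
  have e : 1 / (2 * γ) * ‖v - w‖ ^ 2 = (1 / γ * ‖v - w‖ ^ 2) / 2 := by
    field_simp
  rw [e]
  have h3 : s ^ 2 * ((1 / γ) * ‖v - w‖ ^ 2 / 2) ≤ s ^ 2 * (B / 2) := by
    have := hB v hvK w hw
    gcongr
  linarith

theorem condgIter_succ (lo : Vec d → Vec d) (a u : Vec d) (γ : ℝ) (t : ℕ) :
    condgIter lo a u γ (t + 1) = condgStep lo a u γ (condgIter lo a u γ t) :=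
  Function.iterate_succ_apply' _ _ _

theorem condgIter_mem (hK : Convex ℝ K) (hlo : IsLinearOracle K lo) (hγ : 0 < γ) (hu : u ∈ K)
    (t : ℕ) : condgIter lo a u γ t ∈ K := by
  induction t with
  | zero => exact hu
  | succ t ih => rw [condgIter_succ]; exact condgStep_mem hK hlo hγ ih

/-- The procedure stops after at most `O(B / η)` steps. -/
theorem exists_mem_condgStops (hK : Convex ℝ K) (hlo : IsLinearOracle K lo) (hγ : 0 < γ)
    (hu : u ∈ K) {B η : ℝ} (hB : ∀ x ∈ K, ∀ y ∈ K, (1 / γ) * ‖x - y‖ ^ 2 ≤ B)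
    (hη : 0 < η) (hηB : η ≤ B) {S : ℕ} (hS : 2 * B / η < S) :
    ∃ t < 2 * S, t ∈ condgStops lo a u γ η := by
  by_contra! hcon
  have hV : ∀ t < 2 * S, η < condgGap lo a u γ (condgIter lo a u γ t) := fun t ht => by
    have := hcon t ht
    simpa [condgStops] using this
  have hBpos : 0 < B := hη.trans_le hηB
  have hmem := condgIter_mem (a := a) hK hlo hγ hu
  -- Suboptimality is measured against the last iterate considered, so no minimizer is needed and `h
  -- (2 * S) = 0`.
  set h : ℕ → ℝ := fun t => condgObj a u γ (condgIter lo a u γ t)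
    - condgObj a u γ (condgIter lo a u γ (2 * S)) with hh
  have hgap : ∀ t, h t ≤ condgGap lo a u γ (condgIter lo a u γ t) := fun t =>
    condgObj_sub_le_condgGap hlo hγ _ (hmem _)
  have hstep : ∀ t, ∀ s : ℝ, s ≤ 1 →
      h (t + 1) ≤ h t - s * condgGap lo a u γ (condgIter lo a u γ t) + s ^ 2 * (B / 2) := by
    intro t s hs
    have := condgObj_condgStep_le (a := a) (u := u) hlo hγ hB (hmem t) hs
    simp only [hh]
    rw [condgIter_succ]
    linarith
  -- First phase: the classical `O(1 / t)` Frank-Wolfe rate, with comparison steps `1` and then `2 /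
  -- (t + 3)`.
  have hrate : ∀ t : ℕ, h (t + 1) ≤ 2 * B / ((t : ℝ) + 2) := by
    intro t
    induction t with
    | zero =>
      have h1 := hstep 0 1 le_rfl
      have h2 := hgap 0
      simp only [Nat.cast_zero, zero_add] at *
      linarith
    | succ t ih =>
      have ht : (0 : ℝ) ≤ t := Nat.cast_nonneg t
      have hs1 : (2 : ℝ) / (t + 3) ≤ 1 := by rw [div_le_one (by positivity)]; linarith
      have h1 := hstep (t + 1) (2 / (t + 3)) hs1
      have h2 := mul_le_mul_of_nonneg_left (hgap (t + 1))
        (show (0 : ℝ) ≤ 2 / (t + 3) by positivity)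
      have h3 := mul_le_mul_of_nonneg_left ih (sub_nonneg.2 hs1)
      have h4 : (1 - 2 / ((t : ℝ) + 3)) * (2 * B / (t + 2)) + (2 / ((t : ℝ) + 3)) ^ 2 * (B / 2)
          ≤ 2 * B / (t + 3) := by
        have e : 2 * B / ((t : ℝ) + 3) - ((1 - 2 / ((t : ℝ) + 3)) * (2 * B / (t + 2))
            + (2 / ((t : ℝ) + 3)) ^ 2 * (B / 2)) = 2 * B / ((t + 2) * (t + 3) ^ 2) := by
          field_simp
          ring
        have : 0 ≤ 2 * B / (((t : ℝ) + 2) * (t + 3) ^ 2) := by positivity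
        linarith
      push_cast
      rw [show (t : ℝ) + 1 + 2 = t + 3 by ring]
      linarith
  have hSpos : 0 < S := by
    have : (0 : ℝ) < S := lt_of_le_of_lt (by positivity) hS
    exact_mod_cast this
  -- Second phase: while the gap exceeds `η`, the comparison step `η / B` forces a decrease of at
  -- least `η ^ 2 / (2 * B)`. After `S` such steps this exceeds the `2 * B / (S + 1)` left by the
  -- first phase.
  have hdecr : ∀ j ≤ S, h (S + j) ≤ h S - j * (η ^ 2 / (2 * B)) := by
    intro j
    induction j with
    | zero => intro _; simp
    | succ j ih =>
      intro hj
      have h1 := hstep (S + j) (η / B) ((div_le_one hBpos).2 hηB)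
      have h2 := mul_le_mul_of_nonneg_left (hV (S + j) (by omega)).le
        (show 0 ≤ η / B by positivity)
      have h3 := ih (by omega)
      have e : -(η / B * η) + (η / B) ^ 2 * (B / 2) = -(η ^ 2 / (2 * B)) := by
        field_simp
        ring
      push_cast
      rw [← add_assoc]
      linarith
  have h0 : h (2 * S) = 0 := sub_self _
  have h1 := hdecr S le_rfl
  rw [← two_mul, h0] at h1
  obtain ⟨n, rfl⟩ := Nat.exists_eq_succ_of_ne_zero hSpos.ne'
  have h2 := hrate n
  simp only [Nat.succ_eq_add_one] at *
  push_cast at h1 hS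
  have hn : (0 : ℝ) ≤ n := Nat.cast_nonneg n
  rw [div_lt_iff₀ hη] at hS
  have h3 : ((n : ℝ) + 1) * (η ^ 2 / (2 * B)) ≤ 2 * B / (n + 2) := by linarith
  rw [mul_div_assoc', div_le_div_iff₀ (by positivity) (by positivity)] at h3
  have h5 : (2 * B) * (2 * B) < (((n : ℝ) + 1) * η) * ((n + 1) * η) :=
    mul_self_lt_mul_self (by positivity) hS
  nlinarith [mul_nonneg hn (sq_nonneg η)]

theorem condgCalls_le (hK : Convex ℝ K) (hlo : IsLinearOracle K lo) (hγ : 0 < γ)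
    (hu : u ∈ K) {B η : ℝ} (hB : ∀ x ∈ K, ∀ y ∈ K, (1 / γ) * ‖x - y‖ ^ 2 ≤ B)
    (hη : 0 < η) (hηB : η ≤ B) {S : ℕ} (hS : 2 * B / η < S) :
    condgCalls lo a u γ η ≤ ((2 * S : ℕ) : ℕ∞) := by
  obtain ⟨t, ht, htm⟩ := exists_mem_condgStops (a := a) hK hlo hγ hu hB hη hηB hS
  exact (iInf₂_le t htm).trans (Nat.cast_le.2 ht)

/-- The stopping test bounds a maximum over `K`, hence is itself the approximate variational
inequality. Termination rules out the default value `sInf ∅ = 0`. -/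
theorem isApproxProx_condg (hK : Convex ℝ K) (hlo : IsLinearOracle K lo) (hγ : 0 < γ)
    (hu : u ∈ K) {B η : ℝ} (hB : ∀ x ∈ K, ∀ y ∈ K, (1 / γ) * ‖x - y‖ ^ 2 ≤ B)
    (hη : 0 < η) (hηB : η ≤ B) : IsApproxProx K u a γ η (condg lo a u γ η) := by
  obtain ⟨S, hS⟩ := exists_nat_gt (2 * B / η)
  obtain ⟨t, -, ht⟩ := exists_mem_condgStops (a := a) hK hlo hγ hu hB hη hηB hS
  have hs : sInf (condgStops lo a u γ η) ∈ condgStops lo a u γ η := Nat.sInf_mem ⟨t, ht⟩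
  exact ⟨condgIter_mem hK hlo hγ hu _, fun θ hθ => (inner_le_condgGap hlo _ hθ).trans hs⟩

/-! ### Measurability of the procedure `condg` -/

section Measurability

variable {Ω : Type*} [MeasurableSpace Ω] {A U Y : Ω → Vec d}

theorem measurable_condgGrad (γ : ℝ) (hA : Measurable A)
    (hU : Measurable U) (hY : Measurable Y) :
    Measurable fun ω => A ω + (1 / γ) • (Y ω - U ω) := by
  fun_prop

theorem measurable_condgVertex (hlo : Measurable lo) (γ : ℝ) (hA : Measurable A)
    (hU : Measurable U) (hY : Measurable Y) :
    Measurable fun ω => condgVertex lo (A ω) (U ω) γ (Y ω) :=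
  hlo.comp (measurable_condgGrad γ hA hU hY)

theorem measurable_condgGap (hlo : Measurable lo) (γ : ℝ) (hA : Measurable A)
    (hU : Measurable U) (hY : Measurable Y) :
    Measurable fun ω => condgGap lo (A ω) (U ω) γ (Y ω) := by
  have hv := measurable_condgVertex hlo γ hA hU hY
  have hg := measurable_condgGrad γ hA hU hY
  unfold condgGap
  exact Measurable.inner hg (Measurable.sub hY hv)

theorem measurable_condgStepSize (hlo : Measurable lo) (γ : ℝ) (hA : Measurable A)
    (hU : Measurable U) (hY : Measurable Y) :
    Measurable fun ω => condgStepSize lo (A ω) (U ω) γ (Y ω) := by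
  have hv := measurable_condgVertex hlo γ hA hU hY
  have hg := measurable_condgGap hlo γ hA hU hY
  have hn : Measurable fun ω => ‖condgVertex lo (A ω) (U ω) γ (Y ω) - Y ω‖ ^ 2 :=
    (Measurable.norm (Measurable.sub hv hY)).pow_const 2
  simp only [condgStepSize_eq]
  exact Measurable.min measurable_const (Measurable.div hg (Measurable.const_mul hn _))

theorem measurable_condgStep (hlo : Measurable lo) (γ : ℝ) (hA : Measurable A)
    (hU : Measurable U) (hY : Measurable Y) :
    Measurable fun ω => condgStep lo (A ω) (U ω) γ (Y ω) := by
  have hv := measurable_condgVertex hlo γ hA hU hY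
  have hs := measurable_condgStepSize hlo γ hA hU hY
  unfold condgStep
  exact Measurable.add (Measurable.smul (Measurable.const_sub hs 1) hY) (Measurable.smul hs hv)

theorem measurable_condgIter (hlo : Measurable lo) (γ : ℝ) (hA : Measurable A)
    (hU : Measurable U) (t : ℕ) : Measurable fun ω => condgIter lo (A ω) (U ω) γ t := by
  induction t with
  | zero => exact hU
  | succ t ih =>
    simp only [condgIter_succ]
    exact measurable_condgStep hlo γ hA hU ih

theorem measurable_sInf_nat {s : Ω → Set ℕ} (hs : ∀ t, MeasurableSet {ω | t ∈ s ω}) :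
    Measurable fun ω => sInf (s ω) := by
  classical
  refine measurable_to_countable' fun n => ?_
  have h1 : ∀ m, MeasurableSet {ω | m ∈ s ω ∧ ∀ j < m, j ∉ s ω} := fun m => by
    have e : {ω | m ∈ s ω ∧ ∀ j < m, j ∉ s ω}
        = {ω | m ∈ s ω} ∩ ⋂ j, ⋂ (_ : j < m), {ω | j ∈ s ω}ᶜ := by
      ext ω; simp
    rw [e]
    exact (hs m).inter (MeasurableSet.iInter fun j => MeasurableSet.iInter fun _ => (hs j).compl)
  have h2 : MeasurableSet {ω | ∀ j, j ∉ s ω} := by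
    have e : {ω | ∀ j, j ∉ s ω} = ⋂ j, {ω | j ∈ s ω}ᶜ := by
      ext ω; simp
    rw [e]
    exact MeasurableSet.iInter fun j => (hs j).compl
  -- The second set accounts for `sInf ∅ = 0`.
  have e : (fun ω => sInf (s ω)) ⁻¹' {n} =
      {ω | n ∈ s ω ∧ ∀ j < n, j ∉ s ω} ∪ {ω | (∀ j, j ∉ s ω) ∧ n = 0} := by
    ext ω
    simp only [Set.mem_preimage, Set.mem_singleton_iff, Set.mem_union, Set.mem_ofPred_eq]
    constructor
    · rintro rfl
      by_cases hne : (s ω).Nonempty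
      · exact Or.inl ⟨Nat.sInf_mem hne, fun j hj => Nat.notMem_of_lt_sInf hj⟩
      · rw [Set.not_nonempty_iff_eq_empty] at hne
        exact Or.inr ⟨by simp [hne], by simp [hne]⟩
    · rintro (⟨h, h'⟩ | ⟨h, rfl⟩)
      · refine le_antisymm (Nat.sInf_le h) ?_
        by_contra! hlt
        exact h' _ hlt (Nat.sInf_mem ⟨n, h⟩)
      · rw [Set.eq_empty_of_forall_notMem h, Nat.sInf_empty]
  rw [e]
  exact (h1 n).union (h2.inter (MeasurableSet.const _))

theorem measurable_condg (hlo : Measurable lo) (γ η : ℝ) (hA : Measurable A)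
    (hU : Measurable U) : Measurable fun ω => condg lo (A ω) (U ω) γ η := by
  have hI := measurable_condgIter hlo γ hA hU
  have hT : Measurable fun ω => sInf (condgStops lo (A ω) (U ω) γ η) := by
    refine measurable_sInf_nat fun t => ?_
    have hg := measurable_condgGap hlo γ hA hU (hI t)
    exact measurableSet_le hg measurable_const
  unfold condg
  generalize hF : (fun ω t => condgIter lo (A ω) (U ω) γ t) = F
  generalize hτ : (fun ω => sInf (condgStops lo (A ω) (U ω) γ η)) = τ at hT
  have e : (fun ω => condgIter lo (A ω) (U ω) γ (sInf (condgStops lo (A ω) (U ω) γ η)))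
      = fun ω => F ω (τ ω) := by
    rw [← hF, ← hτ]
  have hF' : ∀ t, Measurable fun ω => F ω t := by
    rw [← hF]; exact hI
  rw [e]
  have hjoint : Measurable fun q : ℕ × Ω => F q.2 q.1 := measurable_from_prod_countable_right hF'
  exact hjoint.comp (hT.prodMk measurable_id)

end Measurability

end

/-! ### The descent inequality for one iteration -/

theorem inner_gradient_eq_fderiv {F : Vec d → ℝ} {x : Vec d} (hF : DifferentiableAt ℝ F x)
    (z : Vec d) : fderiv ℝ F x z = inner ℝ (gradient F x) z := by
  rw [hF.hasGradientAt.hasFDerivAt.fderiv, InnerProductSpace.toDual_apply_apply]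

/-- The descent lemma. -/
theorem LSmoothOn.le_quadratic {K : Set (Vec d)} (hK : Convex ℝ K) {F : Vec d → ℝ}
    (hF : Differentiable ℝ F) {L : ℝ} (hsm : LSmoothOn L K F) {x y : Vec d} (hx : x ∈ K)
    (hy : y ∈ K) :
    F y ≤ F x + inner ℝ (gradient F x) (y - x) + L / 2 * ‖y - x‖ ^ 2 := by
  set c := inner ℝ (gradient F x) (y - x) with hc
  -- The claim is `g 1 ≤ g 0`. Smoothness on `K` is enough for `g' ≤ 0`, since the segment stays in
  -- `K`; no gradient has to be integrated.
  set g : ℝ → ℝ := fun t => F (x + t • (y - x)) - t * c - L / 2 * ‖y - x‖ ^ 2 * t ^ 2 with hg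
  have hder : ∀ t, HasDerivAt g (inner ℝ (gradient F (x + t • (y - x))) (y - x) - c
      - L * ‖y - x‖ ^ 2 * t) t := by
    intro t
    have h1 : HasDerivAt (fun t : ℝ => x + t • (y - x)) (y - x) t := by
      simpa using ((hasDerivAt_id t).smul_const (y - x)).const_add x
    have h2 := (hF (x + t • (y - x))).hasFDerivAt.comp_hasDerivAt t h1
    rw [inner_gradient_eq_fderiv (hF _)] at h2
    have h3 := (h2.sub ((hasDerivAt_id t).mul_const c)).sub
      (((hasDerivAt_id t).pow 2).const_mul (L / 2 * ‖y - x‖ ^ 2))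
    refine h3.congr_deriv ?_
    simp
    ring
  have hanti : AntitoneOn g (Set.Icc 0 1) := by
    refine antitoneOn_of_hasDerivWithinAt_nonpos (convex_Icc 0 1)
      (fun t _ => (hder t).continuousAt.continuousWithinAt)
      (fun t _ => (hder t).hasDerivWithinAt) fun t ht => ?_
    rw [interior_Icc] at ht
    have hmem : x + t • (y - x) ∈ K := hK.add_smul_sub_mem hx hy ⟨ht.1.le, ht.2.le⟩
    have h1 := hsm _ hmem x hx
    rw [add_sub_cancel_left, norm_smul, Real.norm_eq_abs, abs_of_pos ht.1] at h1
    rw [hc, ← inner_sub_left]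
    have h2 := real_inner_le_norm (gradient F (x + t • (y - x)) - gradient F x) (y - x)
    have h3 := mul_le_mul_of_nonneg_right h1 (norm_nonneg (y - x))
    nlinarith
  have h := hanti (Set.left_mem_Icc.2 zero_le_one) (Set.right_mem_Icc.2 zero_le_one) zero_le_one
  simp only [hg] at h
  norm_num at h
  linarith

theorem inner_le_sq_add_sq (x y : Vec d) {c : ℝ} (hc : 0 < c) :
    inner ℝ x y ≤ 1 / (4 * c) * ‖x‖ ^ 2 + c * ‖y‖ ^ 2 := by
  have h := real_inner_le_norm x y
  have h2 : 0 ≤ 1 / (4 * c) * (‖x‖ - 2 * c * ‖y‖) ^ 2 := by positivity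
  have e : 1 / (4 * c) * (‖x‖ - 2 * c * ‖y‖) ^ 2
      = 1 / (4 * c) * ‖x‖ ^ 2 - ‖x‖ * ‖y‖ + c * ‖y‖ ^ 2 := by
    field_simp
    ring
  linarith

/-- The inequality for `ag` is tested at `(1 - α) • ag₀ + α • θ`, the one for `θ` at `x`. The
second, through the three-point identity, supplies `α / (2 * lam) * ‖θ - θ₀‖ ^ 2`, which absorbs the
cross term of the first because `α * lam ≤ β`. -/
theorem one_iteration_inner_le {K : Set (Vec d)} (hK : Convex ℝ K) {L α β lam η χ : ℝ}
    (hα0 : 0 ≤ α) (hα1 : α ≤ 1) (hβ : 0 < β) (hlam : 0 < lam) (hαlam : α * lam ≤ β)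
    (hL : 1 / β = 2 * L)
    {ag₀ θ₀ m θ ag x g : Vec d} (hm : m = (1 - α) • ag₀ + α • θ₀) (hag₀ : ag₀ ∈ K)
    (hx : x ∈ K) (hθ : IsApproxProx K θ₀ g lam η θ) (hag : IsApproxProx K m g β χ ag) :
    inner ℝ g (ag - m + α • (θ₀ - x)) ≤ χ + α * η - L * ‖ag - m‖ ^ 2
      + α / (2 * lam) * (‖θ₀ - x‖ ^ 2 - ‖θ - x‖ ^ 2) := by
  have hz : m + α • (θ - θ₀) ∈ K := by
    have : m + α • (θ - θ₀) = (1 - α) • ag₀ + α • θ := by rw [hm]; module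
    rw [this]
    exact hK hag₀ hθ.1 (by linarith) hα0 (by ring)
  have h1 := hag.2 _ hz
  have h2 := mul_le_mul_of_nonneg_left (hθ.2 x hx) hα0
  have e1 : ag - (m + α • (θ - θ₀)) = (ag - m) - α • (θ - θ₀) := by abel
  rw [e1, inner_add_left, real_inner_smul_left, inner_sub_right (ag - m), real_inner_smul_right,
    real_inner_self_eq_norm_sq, hL] at h1
  rw [inner_add_left, real_inner_smul_left] at h2
  have e2 : inner ℝ (θ - θ₀) (θ - x)
      = (‖θ - θ₀‖ ^ 2 + ‖θ - x‖ ^ 2 - ‖θ₀ - x‖ ^ 2) / 2 := by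
    have e3 : θ₀ - x = (θ - x) - (θ - θ₀) := by abel
    rw [e3, norm_sub_sq_real (θ - x) (θ - θ₀), real_inner_comm]
    ring
  rw [e2] at h2
  have h3 := inner_le_sq_add_sq (ag - m) (α • (θ - θ₀)) (c := 1 / 2) (by norm_num)
  rw [norm_smul, mul_pow, Real.norm_eq_abs, sq_abs, real_inner_smul_right] at h3
  have hL0 : 0 < 2 * L := by rw [← hL]; positivity
  have h3' := mul_le_mul_of_nonneg_left h3 hL0.le
  have e4 : inner ℝ g (ag - m + α • (θ₀ - x))
      = inner ℝ g (ag - m - α • (θ - θ₀)) + α * inner ℝ g (θ - x) := by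
    rw [← real_inner_smul_right, ← inner_add_right]
    congr 1
    module
  have h5 : L * (α ^ 2 * ‖θ - θ₀‖ ^ 2) ≤ α / (2 * lam) * ‖θ - θ₀‖ ^ 2 := by
    rw [← mul_assoc]
    refine mul_le_mul_of_nonneg_right ?_ (sq_nonneg _)
    rw [le_div_iff₀ (by positivity)]
    have : 2 * L * (α * lam) ≤ 1 := by
      rw [← hL, one_div, inv_mul_le_iff₀ hβ]
      linarith
    nlinarith
  have e6 : α * (1 / lam * ((‖θ - θ₀‖ ^ 2 + ‖θ - x‖ ^ 2 - ‖θ₀ - x‖ ^ 2) / 2))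
      = α / (2 * lam) * ‖θ - θ₀‖ ^ 2 - α / (2 * lam) * (‖θ₀ - x‖ ^ 2 - ‖θ - x‖ ^ 2) := by
    field_simp
    ring
  rw [e4]
  linarith

/-- The decrease of the objective in one iteration. -/
theorem one_iteration_le {K : Set (Vec d)} (hK : Convex ℝ K) {F : Vec d → ℝ}
    (hF : Differentiable ℝ F) {L l D α β lam η χ : ℝ} (hsm : LSmoothOn L K F)
    (hlow : LowerSmoothOn l K F) (hD : ∀ x ∈ K, ∀ y ∈ K, ‖x - y‖ ^ 2 ≤ D)
    (hα0 : 0 ≤ α) (hα1 : α ≤ 1) (hβ : 0 < β) (hlam : 0 < lam) (hαlam : α * lam ≤ β)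
    (hL : 1 / β = 2 * L)
    {ag₀ θ₀ m θ ag x g : Vec d} (hm : m = (1 - α) • ag₀ + α • θ₀) (hag₀ : ag₀ ∈ K)
    (hθ₀ : θ₀ ∈ K)
    (hx : x ∈ K) (hθ : IsApproxProx K θ₀ g lam η θ) (hag : IsApproxProx K m g β χ ag) :
    F ag - F x ≤ (1 - α) * (F ag₀ - F x) + χ + α * η - L / 4 * ‖ag - m‖ ^ 2
      + α / (2 * lam) * (‖θ₀ - x‖ ^ 2 - ‖θ - x‖ ^ 2) + |l| * (α * D)
      + (1 / L + 1) * ‖g - gradient F m‖ ^ 2 + α ^ 2 / 4 * D := by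
  have hL0 : 0 < L := by
    have : 0 < 2 * L := by rw [← hL]; positivity
    linarith
  have hmK : m ∈ K := by
    rw [hm]
    exact hK hag₀ hθ₀ (by linarith) hα0 (by ring)
  have h1 := hsm.le_quadratic hK hF hmK hag.1
  have h2 := one_iteration_inner_le hK hα0 hα1 hβ hlam hαlam hL hm hag₀ hx hθ hag
  set δ := g - gradient F m with hδ
  -- `l` may be negative; with `|l|` the squared distances can be replaced by upper bounds.
  have habs : -(|l| / 2) ≤ -(l / 2) := by linarith [le_abs_self l]
  have hl : ∀ y ∈ K, F m ≤ F y + inner ℝ (gradient F m) (m - y) + |l| / 2 * ‖y - m‖ ^ 2 := by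
    intro y hy
    have h := hlow y hy m hmK
    rw [← neg_sub m y, inner_neg_right, neg_sub] at h
    have h' := mul_le_mul_of_nonneg_right habs (sq_nonneg ‖y - m‖)
    linarith
  have h3 := mul_le_mul_of_nonneg_left (hl ag₀ hag₀) (sub_nonneg.2 hα1)
  have h4 := mul_le_mul_of_nonneg_left (hl x hx) hα0
  have e1 : (1 - α) * inner ℝ (gradient F m) (m - ag₀) + α * inner ℝ (gradient F m) (m - x)
      = inner ℝ (gradient F m) (α • (θ₀ - x)) := by
    rw [← real_inner_smul_right, ← real_inner_smul_right, ← inner_add_right]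
    congr 1
    rw [hm]
    module
  -- Since `ag₀ - m = α • (ag₀ - θ₀)`, the nonconvexity error at `ag₀` is also of order `α`; without
  -- this factor the weighted errors would sum to order `N ^ 3`.
  have hag₀m : (1 - α) * ‖ag₀ - m‖ ^ 2 ≤ α * D := by
    have e : ag₀ - m = α • (ag₀ - θ₀) := by rw [hm]; module
    have hD0 : 0 ≤ D := (sq_nonneg _).trans (hD ag₀ hag₀ θ₀ hθ₀)
    rw [e, norm_smul, mul_pow, Real.norm_eq_abs, sq_abs]
    calc (1 - α) * (α ^ 2 * ‖ag₀ - θ₀‖ ^ 2) ≤ 1 * (α ^ 2 * D) := by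
          have := hD ag₀ hag₀ θ₀ hθ₀
          gcongr
          linarith
      _ ≤ α * D := by nlinarith [mul_nonneg (mul_nonneg hα0 (sub_nonneg.2 hα1)) hD0]
  have hxm : α * ‖x - m‖ ^ 2 ≤ α * D := mul_le_mul_of_nonneg_left (hD x hx m hmK) hα0
  have h5 := mul_le_mul_of_nonneg_left (add_le_add hag₀m hxm)
    (show 0 ≤ |l| / 2 by positivity)
  have e2 : inner ℝ (gradient F m) (ag - m) + inner ℝ (gradient F m) (α • (θ₀ - x))
      = inner ℝ g (ag - m + α • (θ₀ - x)) + inner ℝ δ (-(ag - m))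
        + inner ℝ δ (-(α • (θ₀ - x))) := by
    rw [hδ, inner_neg_right, inner_neg_right, inner_sub_left, inner_sub_left, inner_add_right]
    ring
  -- Of the available `L * ‖ag - m‖ ^ 2`, the descent lemma uses `L / 2` and this instance of
  -- Young's inequality `L / 4`; the remaining `L / 4` is the gain.
  have h6 := inner_le_sq_add_sq δ (-(ag - m)) (c := L / 4) (by positivity)
  have h7 := inner_le_sq_add_sq δ (-(α • (θ₀ - x))) (c := 1 / 4) (by positivity)
  rw [norm_neg] at h6 h7
  rw [norm_smul, mul_pow, Real.norm_eq_abs, sq_abs] at h7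
  have h8 := mul_le_mul_of_nonneg_left (hD θ₀ hθ₀ x hx) (sq_nonneg α)
  have e3 : 1 / (4 * (L / 4)) = 1 / L := by congr 1; ring
  rw [e3] at h6
  linarith

section

/-! ### The weights -/

theorem inv_Gam (k : ℕ) : (Gam k)⁻¹ = (k : ℝ) * (k + 1) / 2 := by
  unfold Gam
  rw [inv_div]

theorem sum_inv_Gam (N : ℕ) :
    ∑ k ∈ Finset.Icc 1 N, (Gam k)⁻¹ = (N : ℝ) * (N + 1) * (N + 2) / 6 := by
  induction N with
  | zero => simp
  | succ n ih =>
    rw [Finset.sum_Icc_succ_top (by omega), ih, inv_Gam]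
    push_cast
    ring

theorem sum_Icc_cast (N : ℕ) : ∑ k ∈ Finset.Icc 1 N, (k : ℝ) = (N : ℝ) * (N + 1) / 2 := by
  induction N with
  | zero => simp
  | succ n ih =>
    rw [Finset.sum_Icc_succ_top (by omega), ih]
    push_cast
    ring

/-! ### The run of the method along a fixed sequence of samples -/

variable {Ξ : Type*} {K : Set (Vec d)} {lo : Vec d → Vec d} {θ₀ : Vec d} {L D : ℝ} {N : ℕ}

/-- This curvature bound is uniform in `k` and shared with `lam`. The added `1` guarantees that the
tolerance `1 / N` does not exceed it, even if `D = 0`. -/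
theorem one_div_beta_mul_le (hL : 0 < L) (hD : ∀ x ∈ K, ∀ y ∈ K, ‖x - y‖ ^ 2 ≤ D) (k : ℕ) :
    ∀ x ∈ K, ∀ y ∈ K, (1 / (stdParams L N).β k) * ‖x - y‖ ^ 2 ≤ 4 * L * D + 1 := by
  intro x hx y hy
  have h := hD x hx y hy
  have e : 1 / (stdParams L N).β k = 2 * L := by
    change 1 / (1 / (2 * L)) = 2 * L
    rw [one_div_one_div]
  rw [e]
  nlinarith [sq_nonneg ‖x - y‖, mul_le_mul_of_nonneg_left h hL.le,
    mul_nonneg hL.le ((sq_nonneg _).trans h)]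

theorem one_div_lam_mul_le (hL : 0 < L) (hD : ∀ x ∈ K, ∀ y ∈ K, ‖x - y‖ ^ 2 ≤ D) (k : ℕ) :
    ∀ x ∈ K, ∀ y ∈ K, (1 / (stdParams L N).lam (k + 1)) * ‖x - y‖ ^ 2 ≤ 4 * L * D + 1 := by
  intro x hx y hy
  have h := hD x hx y hy
  have e : 1 / (stdParams L N).lam (k + 1) ≤ 4 * L := by
    change 1 / (((k + 1 : ℕ) : ℝ) * (1 / (2 * L)) / 2) ≤ 4 * L
    have e' : 1 / (((k + 1 : ℕ) : ℝ) * (1 / (2 * L)) / 2) = 4 * L / ((k : ℝ) + 1) := by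
      push_cast
      field_simp
      norm_num
    rw [e']
    exact div_le_self (by positivity) (by linarith [Nat.cast_nonneg (α := ℝ) k])
  calc _ ≤ 4 * L * D := mul_le_mul e h (sq_nonneg _) (by positivity)
    _ ≤ _ := by linarith

theorem stdParams_lam_pos (hL : 0 < L) (k : ℕ) : 0 < (stdParams L N).lam (k + 1) := by
  change 0 < ((k + 1 : ℕ) : ℝ) * (1 / (2 * L)) / 2
  positivity

theorem stdParams_beta_pos (hL : 0 < L) (k : ℕ) : 0 < (stdParams L N).β k := by
  change 0 < 1 / (2 * L)
  positivity

theorem stdParams_alpha_nonneg (k : ℕ) : 0 ≤ (stdParams L N).α k := by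
  change 0 ≤ 2 / ((k : ℝ) + 1)
  positivity

theorem stdParams_alpha_le_one (k : ℕ) : (stdParams L N).α (k + 1) ≤ 1 := by
  change 2 / (((k + 1 : ℕ) : ℝ) + 1) ≤ 1
  rw [div_le_one (by positivity)]
  push_cast
  linarith [Nat.cast_nonneg (α := ℝ) k]

theorem one_div_cast_le_diam_bound (hL : 0 < L) (hN : 1 ≤ N)
    (hD : ∀ x ∈ K, ∀ y ∈ K, ‖x - y‖ ^ 2 ≤ D) (hθ₀ : θ₀ ∈ K) :
    1 / (N : ℝ) ≤ 4 * L * D + 1 := by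
  have h0 : 0 ≤ D := (sq_nonneg _).trans (hD θ₀ hθ₀ θ₀ hθ₀)
  have h1 : 1 / (N : ℝ) ≤ 1 := by
    rw [div_le_one (by positivity)]
    exact_mod_cast hN
  have : 0 ≤ 4 * L * D := by positivity
  linarith

theorem mdOf_mem (hK : Convex ℝ K) {st : State d} (hθ : st.θ ∈ K) (hag : st.ag ∈ K) (k : ℕ) :
    mdOf (stdParams L N) (k + 1) st ∈ K :=
  hK hag hθ (sub_nonneg.2 (stdParams_alpha_le_one k)) (stdParams_alpha_nonneg _) (by ring)

theorem run_mem (hK : Convex ℝ K) (hlo : IsLinearOracle K lo) (hL : 0 < L) (hN : 1 ≤ N)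
    (hD : ∀ x ∈ K, ∀ y ∈ K, ‖x - y‖ ^ 2 ≤ D) (hθ₀ : θ₀ ∈ K) (G : Vec d → Ξ → Vec d)
    (s : ℕ × ℕ → Ξ) (k : ℕ) :
    (run (stdParams L N) G lo θ₀ s k).θ ∈ K ∧ (run (stdParams L N) G lo θ₀ s k).ag ∈ K := by
  have hNpos : 0 < 1 / (N : ℝ) := by positivity
  have hB := one_div_cast_le_diam_bound hL hN hD hθ₀
  induction k with
  | zero => exact ⟨hθ₀, hθ₀⟩
  | succ k ih =>
    exact ⟨(isApproxProx_condg hK hlo (stdParams_lam_pos hL k) ih.1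
        (one_div_lam_mul_le hL hD k) hNpos hB).1,
      (isApproxProx_condg hK hlo (stdParams_beta_pos hL _) (mdOf_mem hK ih.1 ih.2 k)
        (one_div_beta_mul_le hL hD _) hNpos hB).1⟩

theorem mdPoint_mem (hK : Convex ℝ K) (hlo : IsLinearOracle K lo) (hL : 0 < L) (hN : 1 ≤ N)
    (hD : ∀ x ∈ K, ∀ y ∈ K, ‖x - y‖ ^ 2 ≤ D) (hθ₀ : θ₀ ∈ K) (G : Vec d → Ξ → Vec d)
    (s : ℕ × ℕ → Ξ) {k : ℕ} (hk : 1 ≤ k) :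
    mdPoint (stdParams L N) G lo θ₀ s k ∈ K := by
  obtain ⟨k, rfl⟩ := Nat.exists_eq_add_of_le' hk
  have h := run_mem hK hlo hL hN hD hθ₀ G s k
  exact mdOf_mem hK h.1 h.2 k

theorem isApproxProx_run_theta (hK : Convex ℝ K) (hlo : IsLinearOracle K lo) (hL : 0 < L)
    (hN : 1 ≤ N) (hD : ∀ x ∈ K, ∀ y ∈ K, ‖x - y‖ ^ 2 ≤ D) (hθ₀ : θ₀ ∈ K)
    (G : Vec d → Ξ → Vec d) (s : ℕ × ℕ → Ξ) (k : ℕ) :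
    IsApproxProx K (run (stdParams L N) G lo θ₀ s k).θ
      (avgGrad (stdParams L N) G lo θ₀ s (k + 1)) ((stdParams L N).lam (k + 1)) (1 / N)
      (run (stdParams L N) G lo θ₀ s (k + 1)).θ :=
  isApproxProx_condg hK hlo (stdParams_lam_pos hL k) (run_mem hK hlo hL hN hD hθ₀ G s k).1
    (one_div_lam_mul_le hL hD k) (by positivity) (one_div_cast_le_diam_bound hL hN hD hθ₀)

theorem isApproxProx_run_ag (hK : Convex ℝ K) (hlo : IsLinearOracle K lo) (hL : 0 < L)
    (hN : 1 ≤ N) (hD : ∀ x ∈ K, ∀ y ∈ K, ‖x - y‖ ^ 2 ≤ D) (hθ₀ : θ₀ ∈ K)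
    (G : Vec d → Ξ → Vec d) (s : ℕ × ℕ → Ξ) (k : ℕ) :
    IsApproxProx K (mdPoint (stdParams L N) G lo θ₀ s (k + 1))
      (avgGrad (stdParams L N) G lo θ₀ s (k + 1)) ((stdParams L N).β (k + 1)) (1 / N)
      (run (stdParams L N) G lo θ₀ s (k + 1)).ag :=
  isApproxProx_condg hK hlo (stdParams_beta_pos hL _)
    (mdPoint_mem hK hlo hL hN hD hθ₀ G s (Nat.le_add_left 1 k))
    (one_div_beta_mul_le hL hD _) (by positivity) (one_div_cast_le_diam_bound hL hN hD hθ₀)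

/-- The number of stochastic first-order oracle calls. -/
theorem run_sfo_le (G : Vec d → Ξ → Vec d) (s : ℕ × ℕ → Ξ) {k : ℕ} (hk : k ≤ N) :
    ((run (stdParams L N) G lo θ₀ s k).sfo : ℝ) ≤ k * N := by
  induction k with
  | zero => simp [run]
  | succ k ih =>
    have h := ih (by omega)
    have e : (run (stdParams L N) G lo θ₀ s (k + 1)).sfo
      = (run (stdParams L N) G lo θ₀ s k).sfo + (k + 1) := rfl
    have hk' : ((k : ℝ) + 1) ≤ N := by exact_mod_cast hk
    rw [e]
    push_cast
    linarith

/-- The number of linear oracle calls. -/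
theorem run_lo_le (hK : Convex ℝ K) (hlo : IsLinearOracle K lo) (hL : 0 < L) (hN : 1 ≤ N)
    (hD : ∀ x ∈ K, ∀ y ∈ K, ‖x - y‖ ^ 2 ≤ D) (hθ₀ : θ₀ ∈ K) (G : Vec d → Ξ → Vec d)
    (s : ℕ × ℕ → Ξ) {S : ℕ} (hS : 2 * (4 * L * D + 1) / (1 / (N : ℝ)) < S) (k : ℕ) :
    (run (stdParams L N) G lo θ₀ s k).lo ≤ ((k * (4 * S) : ℕ) : ℕ∞) := by
  have hNpos : 0 < 1 / (N : ℝ) := by positivity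
  have hB := one_div_cast_le_diam_bound hL hN hD hθ₀
  induction k with
  | zero => simp [run]
  | succ k ih =>
    have hm := run_mem hK hlo hL hN hD hθ₀ G s k
    have h1 := condgCalls_le (a := avgGrad (stdParams L N) G lo θ₀ s (k + 1)) hK hlo
      (stdParams_lam_pos (N := N) hL k) hm.1 (one_div_lam_mul_le hL hD k) hNpos hB hS
    have h2 := condgCalls_le (a := avgGrad (stdParams L N) G lo θ₀ s (k + 1)) hK hlo
      (stdParams_beta_pos (N := N) hL (k + 1)) (mdOf_mem (L := L) (N := N) hK hm.1 hm.2 k)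
      (one_div_beta_mul_le hL hD _) hNpos hB hS
    have h3 := add_le_add (add_le_add ih h1) h2
    refine le_trans h3 (le_of_eq ?_)
    push_cast
    ring

/-- The weighted sum of the squared gradient mappings along the run. -/
theorem sum_weighted_iteration_le (hK : Convex ℝ K) (hlo : IsLinearOracle K lo) (hL : 0 < L)
    (hN : 1 ≤ N) (hD : ∀ x ∈ K, ∀ y ∈ K, ‖x - y‖ ^ 2 ≤ D) (hθ₀ : θ₀ ∈ K)
    {F : Vec d → ℝ} {l : ℝ} (hF : Differentiable ℝ F) (hsm : LSmoothOn L K F)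
    (hlow : LowerSmoothOn l K F) {x : Vec d} (hx : x ∈ K) (G : Vec d → Ξ → Vec d)
    (s : ℕ × ℕ → Ξ) (n : ℕ) :
    (Gam n)⁻¹ * (F (run (stdParams L N) G lo θ₀ s n).ag - F x)
      + ∑ k ∈ Finset.Icc 1 n, L / 4 * ((Gam k)⁻¹ *
          ‖(run (stdParams L N) G lo θ₀ s k).ag - mdPoint (stdParams L N) G lo θ₀ s k‖ ^ 2)
    ≤ ∑ k ∈ Finset.Icc 1 n, (2 / N * (Gam k)⁻¹ + (|l| + 1 / 2) * D * k
        + (1 / L + 1) * ((Gam k)⁻¹ * ‖avgGrad (stdParams L N) G lo θ₀ s k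
          - gradient F (mdPoint (stdParams L N) G lo θ₀ s k)‖ ^ 2))
      + 2 * L * (D - ‖(run (stdParams L N) G lo θ₀ s n).θ - x‖ ^ 2) := by
  induction n with
  -- Division by zero makes `(Gam 0)⁻¹ = 0`, so the initial function value drops out.
  | zero =>
    have h := hD θ₀ hθ₀ x hx
    have h' : 0 ≤ 2 * L * (D - ‖θ₀ - x‖ ^ 2) := mul_nonneg (by positivity) (by linarith)
    simpa [run, Gam] using h'
  | succ n ih =>
    rw [Finset.sum_Icc_succ_top (by omega), Finset.sum_Icc_succ_top (by omega)]
    have hm := run_mem hK hlo hL hN hD hθ₀ G s n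
    have hn : (0 : ℝ) ≤ n := Nat.cast_nonneg n
    have hD0 : 0 ≤ D := (sq_nonneg _).trans (hD x hx x hx)
    have hα : (stdParams L N).α (n + 1) = 2 / ((n : ℝ) + 2) := by
      change 2 / (((n + 1 : ℕ) : ℝ) + 1) = _
      push_cast; ring
    have hβ : (stdParams L N).β (n + 1) = 1 / (2 * L) := rfl
    have hlam : (stdParams L N).lam (n + 1) = ((n : ℝ) + 1) * (1 / (2 * L)) / 2 := by
      change ((n + 1 : ℕ) : ℝ) * (1 / (2 * L)) / 2 = _
      push_cast; ring
    have hαlam : (stdParams L N).α (n + 1) * (stdParams L N).lam (n + 1)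
        ≤ (stdParams L N).β (n + 1) := by
      rw [hα, hβ, hlam]
      have e : 2 / ((n : ℝ) + 2) * (((n : ℝ) + 1) * (1 / (2 * L)) / 2)
        = ((n : ℝ) + 1) / (n + 2) * (1 / (2 * L)) := by field_simp
      rw [e]
      refine mul_le_of_le_one_left (by positivity) ?_
      rw [div_le_one (by positivity)]
      linarith
    have h := one_iteration_le hK hF hsm hlow hD (stdParams_alpha_nonneg (n + 1))
      (stdParams_alpha_le_one n) (stdParams_beta_pos hL _) (stdParams_lam_pos hL n) hαlam
      (by rw [hβ, one_div_one_div])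
      (m := mdPoint (stdParams L N) G lo θ₀ s (n + 1)) rfl hm.2 hm.1 hx
      (isApproxProx_run_theta hK hlo hL hN hD hθ₀ G s n)
      (isApproxProx_run_ag hK hlo hL hN hD hθ₀ G s n)
    rw [hα, hlam, Nat.add_sub_cancel] at h
    set X := F (run (stdParams L N) G lo θ₀ s n).ag - F x
    set Y := F (run (stdParams L N) G lo θ₀ s (n + 1)).ag - F x
    set r := ‖(run (stdParams L N) G lo θ₀ s n).θ - x‖ ^ 2
    set r' := ‖(run (stdParams L N) G lo θ₀ s (n + 1)).θ - x‖ ^ 2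
    set b := ‖(run (stdParams L N) G lo θ₀ s (n + 1)).ag
      - mdPoint (stdParams L N) G lo θ₀ s (n + 1)‖ ^ 2
    set z := ‖avgGrad (stdParams L N) G lo θ₀ s (n + 1)
          - gradient F (mdPoint (stdParams L N) G lo θ₀ s (n + 1))‖ ^ 2
    have hw : (0 : ℝ) ≤ ((n : ℝ) + 1) * (n + 1 + 1) / 2 := by positivity
    have h' := mul_le_mul_of_nonneg_left h hw
    have hNpos : (0 : ℝ) < N := by exact_mod_cast hN
    -- Multiplication by `(Gam (n + 1))⁻¹` turns the coefficient of `X` into `(Gam n)⁻¹` and that of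
    -- `r - r'` into the constant `2 * L`: both telescope.
    have e1 : ((n : ℝ) + 1) * (n + 1 + 1) / 2 * ((1 - 2 / (n + 2)) * X + 1 / N
          + 2 / (n + 2) * (1 / N) - L / 4 * b
          + 2 / (n + 2) / (2 * ((n + 1) * (1 / (2 * L)) / 2)) * (r - r')
          + |l| * (2 / (n + 2) * D) + (1 / L + 1) * z + (2 / (n + 2)) ^ 2 / 4 * D)
        = (n : ℝ) * (n + 1) / 2 * X + (((n : ℝ) + 1) * (n + 2) / 2 * (1 / N) + (n + 1) * (1 / N))
          - L / 4 * (((n : ℝ) + 1) * (n + 2) / 2 * b) + 2 * L * (r - r')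
          + |l| * D * (n + 1) + (1 / L + 1) * (((n : ℝ) + 1) * (n + 2) / 2 * z)
          + (n + 1) / (2 * (n + 2)) * D := by
      field_simp
      ring
    rw [e1] at h'
    have h1 : (n + 1) / (2 * (n + 2)) * D ≤ 1 / 2 * D * ((n : ℝ) + 1) := by
      have : ((n : ℝ) + 1) / (2 * (n + 2)) ≤ 1 / 2 * (n + 1) := by
        rw [div_le_iff₀ (by positivity)]
        nlinarith
      nlinarith [mul_le_mul_of_nonneg_right this hD0]
    have h2 : ((n : ℝ) + 1) * (1 / N) ≤ ((n : ℝ) + 1) * (n + 2) / 2 * (1 / N) := by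
      refine mul_le_mul_of_nonneg_right ?_ (by positivity)
      nlinarith
    have e2 : (2 : ℝ) / N = 2 * (1 / N) := by ring
    simp only [inv_Gam] at ih ⊢
    push_cast
    rw [e2] at ih ⊢
    rw [show (n : ℝ) + 2 = n + 1 + 1 by ring] at h' h1 h2
    linarith

theorem sum_gradMap_sq_le (hne : K.Nonempty) (hKc : IsCompact K) (hK : Convex ℝ K)
    (hlo : IsLinearOracle K lo) (hL : 0 < L)
    (hN : 1 ≤ N) (hD : ∀ x ∈ K, ∀ y ∈ K, ‖x - y‖ ^ 2 ≤ D) (hθ₀ : θ₀ ∈ K)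
    {F : Vec d → ℝ} {l : ℝ} (hF : Differentiable ℝ F) (hsm : LSmoothOn L K F)
    (hlow : LowerSmoothOn l K F) (G : Vec d → Ξ → Vec d) (s : ℕ × ℕ → Ξ) :
    ∑ k ∈ Finset.Icc 1 N, (Gam k)⁻¹ *
        ‖gradMap K (mdPoint (stdParams L N) G lo θ₀ s k)
          (avgGrad (stdParams L N) G lo θ₀ s k) ((stdParams L N).β k)‖ ^ 2
    ≤ (32 * L * (2 + (|l| + 1 / 2 + 2 * L) * D) + 4 * L) * N ^ 2
      + 32 * (1 + L) * ∑ k ∈ Finset.Icc 1 N, (Gam k)⁻¹ *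
        ‖avgGrad (stdParams L N) G lo θ₀ s k
          - gradient F (mdPoint (stdParams L N) G lo θ₀ s k)‖ ^ 2 := by
  -- Comparing with a minimizer makes the final function gap nonnegative, so it can be dropped.
  obtain ⟨x, hx, hmin⟩ := hKc.exists_isMinOn hne hF.continuous.continuousOn
  have h := sum_weighted_iteration_le hK hlo hL hN hD hθ₀ hF hsm hlow hx G s N
  have hNpos : (0 : ℝ) < N := by exact_mod_cast hN
  have hN1 : (1 : ℝ) ≤ N := by exact_mod_cast hN
  have hD0 : 0 ≤ D := (sq_nonneg _).trans (hD x hx x hx)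
  have h0 : 0 ≤ (Gam N)⁻¹ * (F (run (stdParams L N) G lo θ₀ s N).ag - F x) := by
    refine mul_nonneg (by rw [inv_Gam]; positivity) (sub_nonneg.2 ?_)
    exact hmin (run_mem hK hlo hL hN hD hθ₀ G s N).2
  have hcube : (N : ℝ) * (N + 1) * (N + 2) / 6 ≤ N ^ 3 := by
    nlinarith [mul_nonneg hNpos.le (sub_nonneg.2 hN1), mul_nonneg (mul_nonneg hNpos.le hNpos.le)
      (sub_nonneg.2 hN1)]
  rw [Finset.sum_add_distrib, Finset.sum_add_distrib, ← Finset.mul_sum, ← Finset.mul_sum,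
    ← Finset.mul_sum, ← Finset.mul_sum, sum_inv_Gam, sum_Icc_cast] at h
  set Z := ∑ k ∈ Finset.Icc 1 N, (Gam k)⁻¹ * ‖avgGrad (stdParams L N) G lo θ₀ s k
          - gradient F (mdPoint (stdParams L N) G lo θ₀ s k)‖ ^ 2
  set X := ∑ k ∈ Finset.Icc 1 N, (Gam k)⁻¹ * ‖(run (stdParams L N) G lo θ₀ s k).ag
    - mdPoint (stdParams L N) G lo θ₀ s k‖ ^ 2 with hX
  have hpt : ∀ k ∈ Finset.Icc 1 N, (Gam k)⁻¹ *
        ‖gradMap K (mdPoint (stdParams L N) G lo θ₀ s k)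
          (avgGrad (stdParams L N) G lo θ₀ s k) ((stdParams L N).β k)‖ ^ 2
      ≤ 8 * L ^ 2 * ((Gam k)⁻¹ * ‖(run (stdParams L N) G lo θ₀ s k).ag
        - mdPoint (stdParams L N) G lo θ₀ s k‖ ^ 2) + 4 * L / N * (Gam k)⁻¹ := by
    intro k hk
    obtain ⟨k, rfl⟩ := Nat.exists_eq_add_of_le' (Finset.mem_Icc.1 hk).1
    have h1 := norm_gradMap_sq_le hne hKc hK (stdParams_beta_pos hL _)
      (isApproxProx_run_ag hK hlo hL hN hD hθ₀ G s k)
    have e1 : 2 / (stdParams L N).β (k + 1) ^ 2 = 8 * L ^ 2 := by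
      change 2 / (1 / (2 * L)) ^ 2 = _
      field_simp
      norm_num
    have e2 : 2 / (stdParams L N).β (k + 1) * (1 / N) = 4 * L / N := by
      change 2 / (1 / (2 * L)) * (1 / N) = _
      field_simp
      norm_num
    rw [e1, e2] at h1
    have hw : 0 ≤ (Gam (k + 1))⁻¹ := by rw [inv_Gam]; positivity
    have h2 := mul_le_mul_of_nonneg_left h1 hw
    linarith
  refine (Finset.sum_le_sum hpt).trans ?_
  rw [Finset.sum_add_distrib, ← Finset.mul_sum, ← Finset.mul_sum, sum_inv_Gam, ← hX]
  have hr : 0 ≤ 2 * L * ‖(run (stdParams L N) G lo θ₀ s N).θ - x‖ ^ 2 := by positivity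
  have hc1 : 2 / (N : ℝ) * (N * (N + 1) * (N + 2) / 6) ≤ 2 * N ^ 2 := by
    calc 2 / (N : ℝ) * (N * (N + 1) * (N + 2) / 6) ≤ 2 / (N : ℝ) * N ^ 3 := by gcongr
      _ = 2 * N ^ 2 := by field_simp
  have hc2 : (N : ℝ) * (N + 1) / 2 ≤ N ^ 2 := by nlinarith
  have hc3 : (|l| + 1 / 2) * D * (N * (N + 1) / 2) ≤ (|l| + 1 / 2) * D * N ^ 2 := by gcongr
  have hc4 : 2 * L * D ≤ 2 * L * D * N ^ 2 :=
    le_mul_of_one_le_right (by positivity) (one_le_pow₀ hN1)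
  have hc5 : 4 * L / (N : ℝ) * (N * (N + 1) * (N + 2) / 6) ≤ 4 * L * N ^ 2 := by
    calc 4 * L / (N : ℝ) * (N * (N + 1) * (N + 2) / 6) ≤ 4 * L / (N : ℝ) * N ^ 3 := by gcongr
      _ = 4 * L * N ^ 2 := by field_simp
  have h3 : L / 4 * X ≤ (2 + (|l| + 1 / 2 + 2 * L) * D) * N ^ 2 + (1 / L + 1) * Z := by
    linarith
  -- The factor `32 * L` turns the gain `L / 4` into the `8 * L ^ 2 = 2 / β ^ 2` of the gradient
  -- mapping bound.
  have h4 := mul_le_mul_of_nonneg_left h3 (show 0 ≤ 32 * L by positivity)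
  have e4 : 32 * L * (L / 4 * X) = 8 * L ^ 2 * X := by ring
  have e5 : 32 * L * ((2 + (|l| + 1 / 2 + 2 * L) * D) * N ^ 2 + (1 / L + 1) * Z)
      = 32 * L * (2 + (|l| + 1 / 2 + 2 * L) * D) * N ^ 2 + 32 * (1 + L) * Z := by
    field_simp
  rw [e4, e5] at h4
  linarith

end

section

/-! ### Second moments -/

theorem enorm_sq_eq_ofReal {E : Type*} [NormedAddCommGroup E] (x : E) :
    ‖x‖ₑ ^ 2 = ENNReal.ofReal (‖x‖ ^ 2) := by
  rw [← ofReal_norm, ENNReal.ofReal_pow (norm_nonneg x)]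

section SecondMoment

variable {W : Type*} [MeasurableSpace W] {μ : Measure W}

theorem integrable_and_integral_norm_sq_le {Y : W → Vec d} (hY : AEStronglyMeasurable Y μ)
    {v : ℝ} (hv : 0 ≤ v) (h : ∫⁻ ω, ‖Y ω‖ₑ ^ 2 ∂μ ≤ ENNReal.ofReal v) :
    Integrable (fun ω => ‖Y ω‖ ^ 2) μ ∧ ∫ ω, ‖Y ω‖ ^ 2 ∂μ ≤ v := by
  have hm : AEStronglyMeasurable (fun ω => ‖Y ω‖ ^ 2) μ := hY.norm.pow 2
  simp only [enorm_sq_eq_ofReal] at h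
  refine ⟨⟨hm, ?_⟩, ?_⟩
  · rw [hasFiniteIntegral_iff_ofReal (Filter.Eventually.of_forall fun ω => sq_nonneg _)]
    exact h.trans_lt ENNReal.ofReal_lt_top
  · rw [integral_eq_lintegral_of_nonneg_ae (Filter.Eventually.of_forall fun ω => sq_nonneg _) hm]
    exact ENNReal.toReal_le_of_le_ofReal hv h

theorem lintegral_norm_sq_eq {Y : W → Vec d} (hY : Integrable (fun ω => ‖Y ω‖ ^ 2) μ) :
    ∫⁻ ω, ‖Y ω‖ₑ ^ 2 ∂μ = ENNReal.ofReal (∫ ω, ‖Y ω‖ ^ 2 ∂μ) := by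
  simp only [enorm_sq_eq_ofReal]
  rw [ofReal_integral_eq_lintegral_ofReal hY (Filter.Eventually.of_forall fun ω => sq_nonneg _)]

/-- The second moment of a sum of pairwise independent centered random vectors. -/
theorem integrable_and_integral_norm_sum_sq_le [IsProbabilityMeasure μ] {ι : Type*}
    (s : Finset ι) {Y : ι → W → Vec d} (hY : ∀ i ∈ s, MemLp (Y i) 2 μ)
    (h0 : ∀ i ∈ s, ∫ ω, Y i ω ∂μ = 0)
    (hind : ∀ i ∈ s, ∀ j ∈ s, i ≠ j → IndepFun (Y i) (Y j) μ)
    {v : ℝ} (hv : ∀ i ∈ s, ∫ ω, ‖Y i ω‖ ^ 2 ∂μ ≤ v) :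
    Integrable (fun ω => ‖∑ i ∈ s, Y i ω‖ ^ 2) μ ∧
      ∫ ω, ‖∑ i ∈ s, Y i ω‖ ^ 2 ∂μ ≤ s.card * v := by
  classical
  have e : (fun ω => ‖∑ i ∈ s, Y i ω‖ ^ 2)
      = fun ω => ∑ i ∈ s, ∑ j ∈ s, inner ℝ (Y i ω) (Y j ω) := by
    funext ω
    rw [← real_inner_self_eq_norm_sq, sum_inner]
    exact Finset.sum_congr rfl fun i _ => inner_sum _ _ _
  have hint : ∀ i ∈ s, ∀ j ∈ s, Integrable (fun ω => inner ℝ (Y i ω) (Y j ω)) μ :=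
    fun i hi j hj => by
      refine (((hY i hi).norm.integrable_sq).add ((hY j hj).norm.integrable_sq)).mono'
        ((hY i hi).1.inner (hY j hj).1) (Filter.Eventually.of_forall fun ω => ?_)
      have h := norm_inner_le_norm (𝕜 := ℝ) (Y i ω) (Y j ω)
      simp only [Pi.add_apply]
      nlinarith [sq_nonneg (‖Y i ω‖ - ‖Y j ω‖), sq_nonneg ‖Y i ω‖, sq_nonneg ‖Y j ω‖]
  rw [e]
  refine ⟨integrable_finsetSum _ fun i hi => integrable_finsetSum _ fun j hj => hint i hi j hj,
    ?_⟩
  rw [integral_finsetSum _ fun i hi => integrable_finsetSum _ fun j hj => hint i hi j hj]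
  have hcross : ∀ i ∈ s, ∀ j ∈ s, i ≠ j → ∫ ω, inner ℝ (Y i ω) (Y j ω) ∂μ = 0 := by
    intro i hi j hj hij
    have h := (hind i hi j hj hij).integral_bilin ((hY i hi).integrable one_le_two)
      ((hY j hj).integrable one_le_two) (innerSL ℝ)
    rw [h0 i hi, map_zero] at h
    exact h
  have hrow : ∀ i ∈ s, ∫ ω, ∑ j ∈ s, inner ℝ (Y i ω) (Y j ω) ∂μ ≤ v := by
    intro i hi
    rw [integral_finsetSum _ fun j hj => hint i hi j hj,
      Finset.sum_eq_single_of_mem i hi fun j hj hji => hcross i hi j hj hji.symm]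
    simpa only [real_inner_self_eq_norm_sq] using hv i hi
  calc _ ≤ ∑ _i ∈ s, v := Finset.sum_le_sum hrow
    _ = s.card * v := by rw [Finset.sum_const, nsmul_eq_mul]

end SecondMoment

/-! ### Measurability of the run -/

theorem measurable_gradient (F : Vec d → ℝ) : Measurable (gradient F) := by
  have h : Measurable (fderiv ℝ F) := measurable_fderiv ℝ F
  exact (InnerProductSpace.toDual ℝ (Vec d)).symm.continuous.measurable.comp h

section Measurability

variable {Ξ : Type*} [MeasurableSpace Ξ] {G : Vec d → Ξ → Vec d} {lo : Vec d → Vec d}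

theorem measurable_miniBatch {Ω : Type*} [MeasurableSpace Ω] (p : Params)
    (hG : Measurable fun q : Vec d × Ξ => G q.1 q.2) (k : ℕ) {X : Ω → Vec d}
    {s : Ω → ℕ × ℕ → Ξ} (hX : Measurable X) (hs : Measurable s) :
    Measurable fun ω => miniBatch p G (s ω) k (X ω) := by
  have h : ∀ i, Measurable fun ω => G (X ω) (s ω (k, i)) := fun i =>
    hG.comp (hX.prodMk ((measurable_pi_apply (k, i)).comp hs))
  have h' : Measurable fun ω => ∑ i ∈ Finset.Icc 1 (p.m k), G (X ω) (s ω (k, i)) :=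
    Finset.measurable_fun_sum _ fun i _ => h i
  exact h'.const_smul (1 / (p.m k : ℝ))

theorem measurable_smul_add_smul {Ω : Type*} [MeasurableSpace Ω] (a b : ℝ) {X Y : Ω → Vec d}
    (hX : Measurable X) (hY : Measurable Y) : Measurable fun ω => a • X ω + b • Y ω := by
  have h : Continuous fun q : Vec d × Vec d => a • q.1 + b • q.2 := by fun_prop
  exact h.measurable.comp (hX.prodMk hY)

theorem measurable_mdOf {Ω : Type*} [MeasurableSpace Ω] (p : Params) (k : ℕ)
    {st : Ω → State d} (hθ : Measurable fun ω => (st ω).θ) (hag : Measurable fun ω => (st ω).ag) :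
    Measurable fun ω => mdOf p k (st ω) := by
  unfold mdOf
  exact measurable_smul_add_smul (1 - p.α k) (p.α k) hag hθ

theorem measurable_run (p : Params) (hG : Measurable fun q : Vec d × Ξ => G q.1 q.2)
    (hlo : Measurable lo) (θ₀ : Vec d) (k : ℕ) :
    Measurable (fun s : ℕ × ℕ → Ξ => (run p G lo θ₀ s k).θ) ∧
      Measurable (fun s : ℕ × ℕ → Ξ => (run p G lo θ₀ s k).ag) := by
  induction k with
  | zero => exact ⟨measurable_const, measurable_const⟩
  | succ k ih =>
    have hmd : Measurable fun s : ℕ × ℕ → Ξ => mdOf p (k + 1) (run p G lo θ₀ s k) :=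
      measurable_mdOf p (k + 1) ih.1 ih.2
    have hb := measurable_miniBatch p hG (k + 1) hmd measurable_id
    simp only [id] at hb
    have h1 := measurable_condg hlo (p.lam (k + 1)) (p.η (k + 1)) hb ih.1
    have h2 := measurable_condg hlo (p.β (k + 1)) (p.χ (k + 1)) hb hmd
    simp only [run, stepState]
    exact ⟨h1, h2⟩

theorem measurable_mdPoint (p : Params) (hG : Measurable fun q : Vec d × Ξ => G q.1 q.2)
    (hlo : Measurable lo) (θ₀ : Vec d) (k : ℕ) :
    Measurable fun s : ℕ × ℕ → Ξ => mdPoint p G lo θ₀ s k := by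
  have h := measurable_run p hG hlo θ₀ (k - 1)
  exact measurable_mdOf p k h.1 h.2

theorem measurable_avgGrad (p : Params) (hG : Measurable fun q : Vec d × Ξ => G q.1 q.2)
    (hlo : Measurable lo) (θ₀ : Vec d) (k : ℕ) :
    Measurable fun s : ℕ × ℕ → Ξ => avgGrad p G lo θ₀ s k := by
  have h := measurable_miniBatch p hG k (measurable_mdPoint p hG hlo θ₀ k) measurable_id
  simp only [id] at h
  exact h

end Measurability

/-! ### Dependence on the samples -/

section Dependence

variable {Ξ : Type*}

theorem miniBatch_congr (p : Params) (G : Vec d → Ξ → Vec d) {s s' : ℕ × ℕ → Ξ} {k : ℕ}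
    (h : ∀ i ∈ Finset.Icc 1 (p.m k), s (k, i) = s' (k, i)) (x : Vec d) :
    miniBatch p G s k x = miniBatch p G s' k x := by
  unfold miniBatch
  congr 1
  exact Finset.sum_congr rfl fun i hi => by rw [h i hi]

theorem run_congr (p : Params) (G : Vec d → Ξ → Vec d) (lo : Vec d → Vec d) (θ₀ : Vec d)
    {s s' : ℕ × ℕ → Ξ} {k : ℕ}
    (h : ∀ j ∈ Finset.Icc 1 k, ∀ i ∈ Finset.Icc 1 (p.m j), s (j, i) = s' (j, i)) :
    run p G lo θ₀ s k = run p G lo θ₀ s' k := by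
  induction k with
  | zero => rfl
  | succ k ih =>
    have h1 := ih fun j hj => h j (Finset.Icc_subset_Icc_right (Nat.le_succ k) hj)
    have h2 := fun x => miniBatch_congr p G (h (k + 1) (by simp)) x
    simp only [run, stepState, h1, h2]

/-- The sequence `s`, with the entries outside of `S` replaced by `z`. -/
def maskOutside (S : Finset (ℕ × ℕ)) (z : Ξ) (s : ℕ × ℕ → Ξ) : ℕ × ℕ → Ξ :=
  fun j => if j ∈ S then s j else z

theorem maskOutside_of_mem {S : Finset (ℕ × ℕ)} (z : Ξ) (s : ℕ × ℕ → Ξ) {j : ℕ × ℕ}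
    (hj : j ∈ S) : maskOutside S z s j = s j := if_pos hj

theorem measurable_maskOutside [MeasurableSpace Ξ] (S : Finset (ℕ × ℕ)) (z : Ξ) :
    Measurable (maskOutside S z) := by
  refine measurable_pi_lambda _ fun j => ?_
  by_cases h : j ∈ S
  · simpa [maskOutside, h] using measurable_pi_apply j
  · simp [maskOutside, h]

/-- A masked sequence is a measurable function of finitely many samples, so independence of disjoint
finite subfamilies applies while the type stays that of full sequences. -/
theorem indepFun_maskOutside [MeasurableSpace Ξ] {W : Type*} [MeasurableSpace W] {μ : Measure W}
    {ξ : ℕ × ℕ → W → Ξ} (hind : iIndepFun ξ μ) (hm : ∀ j, Measurable (ξ j))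
    {S T : Finset (ℕ × ℕ)} (hST : Disjoint S T) (z : Ξ) :
    IndepFun (fun ω => maskOutside S z fun j => ξ j ω)
      (fun ω => maskOutside T z fun j => ξ j ω) μ := by
  have hext : ∀ U : Finset (ℕ × ℕ), Measurable fun (q : U → Ξ) (j : ℕ × ℕ) =>
      if h : j ∈ U then q ⟨j, h⟩ else z := by
    intro U
    refine measurable_pi_lambda _ fun j => ?_
    by_cases h : j ∈ U
    · simpa [h] using measurable_pi_apply (⟨j, h⟩ : U)
    · simp [h]
  have h := (hind.indepFun_finset S T hST hm).comp (hext S) (hext T)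
  convert h using 1 <;>
  · funext ω j
    simp [maskOutside]

end Dependence

/-! ### The variance of the averaged stochastic gradient -/

section Variance

variable {Ξ W : Type*} [MeasurableSpace Ξ] [MeasurableSpace W] {L l σ M : ℝ} {K : Set (Vec d)}
  {P : Measure Ξ} {f : Vec d → Ξ → ℝ} {μ : Measure W} {ξ : ℕ × ℕ → W → Ξ} {N : ℕ} {R : W → ℕ}

/-- At a fixed point the batch errors are centered and pairwise independent, so the variance of the
mean is at most `k * σ ^ 2 / k ^ 2`. -/
theorem lintegral_miniBatch_sub_le [IsProbabilityMeasure μ]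
    (hprob : IsStochasticProblem L l σ M K P f) (hs : IsSampling P μ ξ N R) {x : Vec d}
    (hx : x ∈ K) {k : ℕ} (hk : 1 ≤ k) :
    ∫⁻ ω, ‖miniBatch (stdParams L N) (stochGrad f) (fun j => ξ j ω) k x
      - gradient (objective P f) x‖ₑ ^ 2 ∂μ ≤ ENNReal.ofReal (σ ^ 2 / k) := by
  set g := gradient (objective P f) x with hg
  have hkpos : (0 : ℝ) < k := by exact_mod_cast hk
  have hGx : Measurable (stochGrad f x) := hprob.measurable_grad.comp measurable_prodMk_left
  have hsub : Measurable fun z => stochGrad f x z - g := Measurable.sub hGx measurable_const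
  set Y : ℕ → W → Vec d := fun i ω => stochGrad f x (ξ (k, i) ω) - g with hY
  have hYm : ∀ i, Measurable (Y i) := fun i => hsub.comp (hs.measurable_sample (k, i))
  have hY2 : ∀ i, Integrable (fun ω => ‖Y i ω‖ ^ 2) μ ∧ ∫ ω, ‖Y i ω‖ ^ 2 ∂μ ≤ σ ^ 2 := by
    intro i
    refine integrable_and_integral_norm_sq_le (hYm i).aestronglyMeasurable (sq_nonneg σ) ?_
    have h := hprob.variance x hx
    rw [← hs.law_sample (k, i), lintegral_map (hs.law_sample (k, i) ▸ hsub.enorm.pow_const 2)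
      (hs.measurable_sample _), hs.law_sample] at h
    exact h
  have hYL : ∀ i, MemLp (Y i) 2 μ := fun i =>
    (memLp_two_iff_integrable_sq_norm (hYm i).aestronglyMeasurable).2 (hY2 i).1
  have hY0 : ∀ i, ∫ ω, Y i ω ∂μ = 0 := by
    intro i
    have hi : Integrable (fun ω => stochGrad f x (ξ (k, i) ω)) μ := by
      have := hprob.integrable_grad x hx
      rw [← hs.law_sample (k, i)] at this
      exact this.comp_measurable (hs.measurable_sample _)
    have hmean : ∫ ω, stochGrad f x (ξ (k, i) ω) ∂μ = g := by
      rw [hg, ← hprob.unbiased x hx]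
      conv_rhs => rw [← hs.law_sample (k, i)]
      rw [integral_map (hs.measurable_sample _).aemeasurable hGx.aestronglyMeasurable]
    simp only [hY]
    rw [integral_sub hi (integrable_const _), hmean, integral_const]
    simp
  have hYind : ∀ i j, i ≠ j → IndepFun (Y i) (Y j) μ := by
    intro i j hij
    have h : IndepFun (ξ (k, i)) (ξ (k, j)) μ := hs.indep_sample.indepFun (by simpa using hij)
    exact h.comp hsub hsub
  obtain ⟨hi, hle⟩ := integrable_and_integral_norm_sum_sq_le (Finset.Icc 1 k)
    (fun i _ => hYL i) (fun i _ => hY0 i) (fun i _ j _ hij => hYind i j hij)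
    (fun i _ => (hY2 i).2)
  have e : ∀ ω, miniBatch (stdParams L N) (stochGrad f) (fun j => ξ j ω) k x - g
      = (1 / (k : ℝ)) • ∑ i ∈ Finset.Icc 1 k, Y i ω := by
    intro ω
    have hm : (stdParams L N).m k = k := rfl
    unfold miniBatch
    simp only [hY, hm]
    rw [Finset.sum_sub_distrib, smul_sub, Finset.sum_const, Nat.card_Icc, Nat.add_sub_cancel,
      ← Nat.cast_smul_eq_nsmul ℝ k g, smul_smul, one_div_mul_cancel hkpos.ne', one_smul]
  simp only [e]
  have e2 : ∀ ω, ‖(1 / (k : ℝ)) • ∑ i ∈ Finset.Icc 1 k, Y i ω‖ ^ 2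
      = (1 / (k : ℝ)) ^ 2 * ‖∑ i ∈ Finset.Icc 1 k, Y i ω‖ ^ 2 := by
    intro ω
    rw [norm_smul, mul_pow, Real.norm_eq_abs, sq_abs]
  rw [lintegral_norm_sq_eq (by simp only [e2]; exact hi.const_mul _)]
  refine ENNReal.ofReal_le_ofReal ?_
  simp only [e2]
  rw [integral_const_mul]
  rw [Nat.card_Icc, Nat.add_sub_cancel] at hle
  calc (1 / (k : ℝ)) ^ 2 * ∫ ω, ‖∑ i ∈ Finset.Icc 1 k, Y i ω‖ ^ 2 ∂μ
      ≤ (1 / (k : ℝ)) ^ 2 * (k * σ ^ 2) := by gcongr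
    _ = σ ^ 2 / k := by field_simp

/-- Freezing: by independence the joint law is a product, so by Tonelli a bound uniform in the
frozen first argument survives inserting `X`. -/
theorem lintegral_comp_indep_le [IsProbabilityMeasure μ] {E E' : Type*} [MeasurableSpace E]
    [MeasurableSpace E'] {X : W → E} {Y : W → E'} (hX : Measurable X) (hY : Measurable Y)
    (hind : IndepFun X Y μ) {Φ : E × E' → ENNReal} (hΦ : Measurable Φ) {c : ENNReal}
    (hc : ∀ x, ∫⁻ ω, Φ (x, Y ω) ∂μ ≤ c) : ∫⁻ ω, Φ (X ω, Y ω) ∂μ ≤ c := by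
  rw [← lintegral_map (g := fun ω => (X ω, Y ω)) hΦ (hX.prodMk hY),
    (indepFun_iff_map_prod_eq_prod_map_map hX.aemeasurable hY.aemeasurable).1 hind]
  have : IsProbabilityMeasure (μ.map X) := Measure.isProbabilityMeasure_map hX.aemeasurable
  have : IsProbabilityMeasure (μ.map Y) := Measure.isProbabilityMeasure_map hY.aemeasurable
  rw [lintegral_prod _ hΦ.aemeasurable]
  calc ∫⁻ x, ∫⁻ y, Φ (x, y) ∂(μ.map Y) ∂(μ.map X) ≤ ∫⁻ _, c ∂(μ.map X) := by
        refine lintegral_mono fun x => ?_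
        rw [lintegral_map (f := fun y => Φ (x, y)) (hΦ.comp measurable_prodMk_left) hY]
        exact hc x
    _ = c := by rw [lintegral_const, measure_univ, mul_one]

/-- The variance bound for the averaged stochastic gradients of the run. -/
theorem lintegral_avgGrad_sub_le [IsProbabilityMeasure P] [IsProbabilityMeasure μ]
    (hprob : IsStochasticProblem L l σ M K P f) (hs : IsSampling P μ ξ N R)
    {lo : Vec d → Vec d} (hlo : Measurable lo) {θ₀ : Vec d} {k : ℕ} (hk : 1 ≤ k)
    (hmem : ∀ s, mdPoint (stdParams L N) (stochGrad f) lo θ₀ s k ∈ K) :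
    ∫⁻ ω, ‖avgGrad (stdParams L N) (stochGrad f) lo θ₀ (fun j => ξ j ω) k
      - gradient (objective P f)
          (mdPoint (stdParams L N) (stochGrad f) lo θ₀ (fun j => ξ j ω) k)‖ₑ ^ 2 ∂μ
      ≤ ENNReal.ofReal (σ ^ 2 / k) := by
  obtain ⟨z⟩ : Nonempty Ξ := P.nonempty_of_neZero
  set S : Finset (ℕ × ℕ) := Finset.range k ×ˢ Finset.range k with hS
  set T : Finset (ℕ × ℕ) := {k} ×ˢ Finset.Icc 1 k with hT
  have hST : Disjoint S T := by
    rw [hS, hT, Finset.disjoint_product]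
    left
    simp
  have hind := indepFun_maskOutside hs.indep_sample hs.measurable_sample hST z
  have hξ : Measurable fun ω => fun j => ξ j ω := measurable_pi_lambda _ hs.measurable_sample
  have hs₁m := (measurable_maskOutside S z).comp hξ
  have hs₂m := (measurable_maskOutside T z).comp hξ
  have hmd : ∀ ω, mdPoint (stdParams L N) (stochGrad f) lo θ₀ (fun j => ξ j ω) k
      = mdPoint (stdParams L N) (stochGrad f) lo θ₀ (maskOutside S z fun j => ξ j ω) k := by
    intro ω
    unfold mdPoint
    congr 1
    refine run_congr _ _ lo θ₀ fun j hj i hi => Eq.symm ?_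
    refine maskOutside_of_mem z (fun j => ξ j ω) ?_
    have hm : (stdParams L N).m j = j := rfl
    rw [hm] at hi
    simp only [Finset.mem_Icc] at hi hj
    simp only [hS, Finset.mem_product, Finset.mem_range]
    omega
  have hmb : ∀ ω x, miniBatch (stdParams L N) (stochGrad f) (fun j => ξ j ω) k x
      = miniBatch (stdParams L N) (stochGrad f) (maskOutside T z fun j => ξ j ω) k x := by
    intro ω x
    refine miniBatch_congr _ _ (fun i hi => Eq.symm ?_) x
    refine maskOutside_of_mem z (fun j => ξ j ω) ?_
    have hm : (stdParams L N).m k = k := rfl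
    rw [hm] at hi
    simp only [hT, Finset.mem_product, Finset.mem_singleton, true_and]
    exact hi
  have hfst : Measurable fun q : (ℕ × ℕ → Ξ) × (ℕ × ℕ → Ξ) => q.1 := measurable_fst
  have hsnd : Measurable fun q : (ℕ × ℕ → Ξ) × (ℕ × ℕ → Ξ) => q.2 := measurable_snd
  have h1 := (measurable_mdPoint (stdParams L N) hprob.measurable_grad hlo θ₀ k).comp hfst
  have h2 := measurable_miniBatch (stdParams L N) hprob.measurable_grad k h1 hsnd
  have h3 := (measurable_gradient (objective P f)).comp h1
  have hΦ := (Measurable.enorm (Measurable.sub h2 h3)).pow_const 2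
  have h4 := lintegral_comp_indep_le hs₁m hs₂m hind hΦ (c := ENNReal.ofReal (σ ^ 2 / k))
  have h5 := fun s => lintegral_miniBatch_sub_le hprob hs (hmem s) hk
  simp only [avgGrad, hmd, hmb, Function.comp_def] at h4 h5 ⊢
  exact h4 h5

end Variance

/-! ### Evaluation at an independent random index -/

/-- Almost surely `X (R ω) ω` is the finite sum of `1_{R = k} * X k`, because the probabilities on
`I` already sum to `1`; independence then factors each term. -/
theorem integral_comp_random_index {W : Type*} [MeasurableSpace W] {μ : Measure W}
    [IsProbabilityMeasure μ] {R : W → ℕ} (hR : Measurable R) {I : Finset ℕ} {q : ℕ → ℝ}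
    (hq0 : ∀ k ∈ I, 0 ≤ q k) (hq1 : ∑ k ∈ I, q k = 1)
    (hlaw : ∀ k ∈ I, μ {ω | R ω = k} = ENNReal.ofReal (q k)) {X : ℕ → W → ℝ}
    (hX : ∀ k ∈ I, Integrable (X k) μ) (hind : ∀ k ∈ I, IndepFun R (X k) μ) :
    (∀ᵐ ω ∂μ, R ω ∈ I) ∧ Integrable (fun ω => X (R ω) ω) μ ∧
      ∫ ω, X (R ω) ω ∂μ = ∑ k ∈ I, q k * ∫ ω, X k ω ∂μ := by
  classical
  have hmeas : ∀ k, MeasurableSet {ω | R ω = k} := fun k => hR (measurableSet_singleton k)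
  have hmem : ∀ᵐ ω ∂μ, R ω ∈ I := by
    have hset : MeasurableSet {ω | R ω ∈ I} := hR I.measurableSet
    have e : {ω | R ω ∈ I} = ⋃ k ∈ I, {ω | R ω = k} := by
      ext ω; simp
    refine (mem_ae_iff_prob_eq_one hset).2 ?_
    rw [e, measure_biUnion_finset (fun i _ j _ hij => Set.disjoint_left.2 fun ω hi hj =>
        hij (hi.symm.trans hj)) fun k _ => hmeas k, Finset.sum_congr rfl hlaw,
      ← ENNReal.ofReal_sum_of_nonneg hq0, hq1, ENNReal.ofReal_one]
  set ind : ℕ → ℕ → ℝ := fun k n => if n = k then 1 else 0 with hindc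
  have hae : (fun ω => X (R ω) ω) =ᵐ[μ] fun ω => ∑ k ∈ I, ind k (R ω) * X k ω := by
    filter_upwards [hmem] with ω hω
    simp only [hindc, ite_mul, one_mul, zero_mul]
    rw [Finset.sum_ite_eq, if_pos hω]
  have hindm : ∀ k, Measurable (ind k) := fun k => measurable_from_top
  have hindeq : ∀ k, (fun ω => ind k (R ω)) = Set.indicator {ω | R ω = k} 1 := by
    intro k
    funext ω
    by_cases h : R ω = k <;> simp [hindc, h]
  have hindint : ∀ k, Integrable (fun ω => ind k (R ω)) μ := by
    intro k
    rw [hindeq]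
    exact (integrable_const 1).indicator (hmeas k)
  have hI : ∀ k ∈ I, IndepFun (fun ω => ind k (R ω)) (X k) μ := fun k hk =>
    (hind k hk).comp (hindm k) measurable_id
  have hprod : ∀ k ∈ I, Integrable (fun ω => ind k (R ω) * X k ω) μ := fun k hk =>
    (hI k hk).integrable_mul (hindint k) (hX k hk)
  have hval : ∀ k ∈ I, ∫ ω, ind k (R ω) ∂μ = q k := by
    intro k hk
    rw [hindeq, integral_indicator_one (hmeas k), measureReal_def, hlaw k hk,
      ENNReal.toReal_ofReal (hq0 k hk)]
  refine ⟨hmem, (integrable_finsetSum _ hprod).congr hae.symm, ?_⟩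
  rw [integral_congr_ae hae, integral_finsetSum _ hprod]
  refine Finset.sum_congr rfl fun k hk => ?_
  rw [(hI k hk).integral_fun_mul_eq_mul_integral (hindint k).aestronglyMeasurable
    (hX k hk).aestronglyMeasurable, hval k hk]

end

section

/-! ### The convergence rate -/

theorem norm_sub_sq_le_of_norm_le {x y : Vec d} {M : ℝ} (hx : ‖x‖ ≤ M) (hy : ‖y‖ ≤ M) :
    ‖x - y‖ ^ 2 ≤ 4 * M ^ 2 := by
  have h : ‖x - y‖ ≤ 2 * M := (norm_sub_le x y).trans (by linarith)
  calc ‖x - y‖ ^ 2 ≤ (2 * M) ^ 2 := by gcongr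
    _ = 4 * M ^ 2 := by ring

/-! ### Compactness of the feasible set and a uniform bound on the gradient mapping. -/

section Problem

variable {Ξ : Type*} [MeasurableSpace Ξ] {L l σ M : ℝ} {K : Set (Vec d)} {P : Measure Ξ}
  {f : Vec d → Ξ → ℝ}

theorem IsStochasticProblem.norm_le (h : IsStochasticProblem L l σ M K P f) {x : Vec d}
    (hx : x ∈ K) : ‖x‖ ≤ M := by
  simpa [prox_zero hx one_pos] using h.prox_bound x hx 0 1 one_pos

theorem IsStochasticProblem.norm_sub_sq_le (h : IsStochasticProblem L l σ M K P f) :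
    ∀ x ∈ K, ∀ y ∈ K, ‖x - y‖ ^ 2 ≤ 4 * M ^ 2 :=
  fun _ hx _ hy => norm_sub_sq_le_of_norm_le (h.norm_le hx) (h.norm_le hy)

theorem IsStochasticProblem.isCompact (h : IsStochasticProblem L l σ M K P f) : IsCompact K := by
  refine Metric.isCompact_of_isClosed_isBounded h.isClosed
    ((Metric.isBounded_closedBall (x := 0) (r := M)).subset fun x hx => ?_)
  simpa using h.norm_le hx

theorem IsStochasticProblem.norm_gradMap_sq_le_const (h : IsStochasticProblem L l σ M K P f)
    {x : Vec d} (hx : x ∈ K) (w : Vec d) (γ : ℝ) :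
    ‖gradMap K x w γ‖ ^ 2 ≤ (1 / γ) ^ 2 * (4 * M ^ 2) := by
  have hp := (isProxPoint_prox h.nonempty h.isCompact x w γ).1
  unfold gradMap
  rw [norm_smul, mul_pow, Real.norm_eq_abs, sq_abs]
  have := h.norm_sub_sq_le x hx _ hp
  gcongr

end Problem

/-! ### Averages with respect to the stopping probabilities. -/

theorem stopProb_nonneg (N k : ℕ) : 0 ≤ stopProb N k := by
  unfold stopProb
  have h : ∀ j, 0 ≤ (Gam j)⁻¹ := fun j => by rw [inv_Gam]; positivity
  exact div_nonneg (h k) (Finset.sum_nonneg fun j _ => h j)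

theorem sum_inv_Gam_pos {N : ℕ} (hN : 1 ≤ N) : 0 < ∑ k ∈ Finset.Icc 1 N, (Gam k)⁻¹ := by
  rw [sum_inv_Gam]
  have : (0 : ℝ) < N := by exact_mod_cast hN
  positivity

theorem sum_stopProb {N : ℕ} (hN : 1 ≤ N) : ∑ k ∈ Finset.Icc 1 N, stopProb N k = 1 := by
  unfold stopProb
  rw [← Finset.sum_div, div_self (sum_inv_Gam_pos hN).ne']

/-- The weights sum to at least `N ^ 3 / 6`, which turns an `N ^ 2` bound into the rate `1 / N`. -/
theorem sum_stopProb_mul_le {N : ℕ} (hN : 1 ≤ N) {x : ℕ → ℝ} {c : ℝ} (hc : 0 ≤ c)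
    (h : ∑ k ∈ Finset.Icc 1 N, (Gam k)⁻¹ * x k ≤ c * N ^ 2) :
    ∑ k ∈ Finset.Icc 1 N, stopProb N k * x k ≤ 6 * c / N := by
  have hNpos : (0 : ℝ) < N := by exact_mod_cast hN
  have e : ∑ k ∈ Finset.Icc 1 N, stopProb N k * x k
      = (∑ k ∈ Finset.Icc 1 N, (Gam k)⁻¹ * x k) / ∑ j ∈ Finset.Icc 1 N, (Gam j)⁻¹ := by
    unfold stopProb
    rw [Finset.sum_div]
    exact Finset.sum_congr rfl fun k _ => by ring
  rw [e, div_le_iff₀ (sum_inv_Gam_pos hN), sum_inv_Gam]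
  refine h.trans ?_
  have e2 : 6 * c / N * ((N : ℝ) * (N + 1) * (N + 2) / 6) = c * ((N + 1) * (N + 2)) := by
    field_simp
  rw [e2]
  refine mul_le_mul_of_nonneg_left ?_ hc
  nlinarith

section Rate

variable {Ξ W : Type*} [MeasurableSpace Ξ] [MeasurableSpace W] {L l σ M : ℝ} {K : Set (Vec d)}
  {P : Measure Ξ} {f : Vec d → Ξ → ℝ} {μ : Measure W} {ξ : ℕ × ℕ → W → Ξ} {N : ℕ} {R : W → ℕ}

theorem IsSampling.integral_comp_index [IsProbabilityMeasure μ] (hs : IsSampling P μ ξ N R)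
    (hN : 1 ≤ N) {H : ℕ → (ℕ × ℕ → Ξ) → ℝ} (hH : ∀ k, Measurable (H k))
    (hint : ∀ k ∈ Finset.Icc 1 N, Integrable (fun ω => H k fun j => ξ j ω) μ) :
    Integrable (fun ω => H (R ω) fun j => ξ j ω) μ ∧
      ∫ ω, H (R ω) (fun j => ξ j ω) ∂μ
        = ∑ k ∈ Finset.Icc 1 N, stopProb N k * ∫ ω, H k (fun j => ξ j ω) ∂μ :=
  (integral_comp_random_index hs.measurable_index (fun k _ => stopProb_nonneg N k)
    (sum_stopProb hN) hs.law_index (X := fun k ω => H k fun j => ξ j ω) hint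
    fun k _ => hs.indep_index.comp measurable_id (hH k)).2

theorem IsSampling.index_mem [IsProbabilityMeasure μ] (hs : IsSampling P μ ξ N R)
    (hN : 1 ≤ N) : ∀ᵐ ω ∂μ, R ω ∈ Finset.Icc 1 N :=
  (integral_comp_random_index hs.measurable_index (fun k _ => stopProb_nonneg N k)
    (sum_stopProb hN) hs.law_index (X := fun _ _ => 0) (fun _ _ => integrable_zero _ _ _)
    fun _ _ => indepFun_const_right _ 0).1

/-- The constant in the convergence rate. -/
def rateConst (L l σ M : ℝ) : ℝ :=
  32 * L * (2 + (|l| + 1 / 2 + 2 * L) * (4 * M ^ 2)) + 4 * L + 32 * (1 + L) * σ ^ 2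

theorem rateConst_nonneg {L : ℝ} (hL : 0 < L) (l σ M : ℝ) : 0 ≤ rateConst L l σ M := by
  unfold rateConst
  positivity

variable {lo : Vec d → Vec d} {θ₀ : Vec d}

theorem integrable_gradMap_sq [IsProbabilityMeasure μ]
    (hprob : IsStochasticProblem L l σ M K P f)
    {X : W → Vec d} {w : W → Vec d} (hX : Measurable X) (hw : Measurable w)
    (hmem : ∀ ω, X ω ∈ K) {γ : ℝ} (hγ : 0 < γ) :
    Integrable (fun ω => ‖gradMap K (X ω) (w ω) γ‖ ^ 2) μ := by
  have hc := continuous_gradMap hprob.nonempty hprob.isCompact hprob.convex hγ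
  have hm : Measurable fun ω => gradMap K (X ω) (w ω) γ := hc.measurable.comp (hX.prodMk hw)
  refine Integrable.of_bound (hm.norm.pow_const 2).aestronglyMeasurable
    ((1 / γ) ^ 2 * (4 * M ^ 2)) (Filter.Eventually.of_forall fun ω => ?_)
  rw [Real.norm_eq_abs, abs_of_nonneg (sq_nonneg _)]
  exact hprob.norm_gradMap_sq_le_const (hmem ω) _ _

theorem expected_gradMap_sq_le [IsProbabilityMeasure P] [IsProbabilityMeasure μ] (hL : 0 < L)
    (hN : 1 ≤ N) (hprob : IsStochasticProblem L l σ M K P f) (hlo : IsLinearOracle K lo)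
    (hθ₀ : θ₀ ∈ K) (hs : IsSampling P μ ξ N R) :
    (Integrable (fun ω => ‖gradMap K
        (mdPoint (stdParams L N) (stochGrad f) lo θ₀ (fun j => ξ j ω) (R ω))
        (avgGrad (stdParams L N) (stochGrad f) lo θ₀ (fun j => ξ j ω) (R ω))
        ((stdParams L N).β (R ω))‖ ^ 2) μ ∧
      ∫ ω, ‖gradMap K
        (mdPoint (stdParams L N) (stochGrad f) lo θ₀ (fun j => ξ j ω) (R ω))
        (avgGrad (stdParams L N) (stochGrad f) lo θ₀ (fun j => ξ j ω) (R ω))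
        ((stdParams L N).β (R ω))‖ ^ 2 ∂μ ≤ 6 * rateConst L l σ M / N) ∧
    (Integrable (fun ω => ‖gradMap K
        (mdPoint (stdParams L N) (stochGrad f) lo θ₀ (fun j => ξ j ω) (R ω))
        (gradient (objective P f)
          (mdPoint (stdParams L N) (stochGrad f) lo θ₀ (fun j => ξ j ω) (R ω)))
        ((stdParams L N).β (R ω))‖ ^ 2) μ ∧
      ∫ ω, ‖gradMap K
        (mdPoint (stdParams L N) (stochGrad f) lo θ₀ (fun j => ξ j ω) (R ω))
        (gradient (objective P f)
          (mdPoint (stdParams L N) (stochGrad f) lo θ₀ (fun j => ξ j ω) (R ω)))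
        ((stdParams L N).β (R ω))‖ ^ 2 ∂μ ≤ 6 * (2 * rateConst L l σ M + 2 * σ ^ 2) / N) := by
  have hne := hprob.nonempty
  have hKc := hprob.isCompact
  have hmdK : ∀ k ∈ Finset.Icc 1 N, ∀ s,
      mdPoint (stdParams L N) (stochGrad f) lo θ₀ s k ∈ K := fun k hk s =>
    mdPoint_mem hprob.convex hlo hL hN hprob.norm_sub_sq_le hθ₀ _ s (Finset.mem_Icc.1 hk).1
  have hsum := sum_gradMap_sq_le hne hKc hprob.convex hlo hL hN hprob.norm_sub_sq_le hθ₀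
    hprob.differentiable hprob.smooth hprob.lower_smooth (stochGrad f)
  have hmd := measurable_mdPoint (stdParams L N) hprob.measurable_grad hlo.measurable θ₀
  have havg := measurable_avgGrad (stdParams L N) hprob.measurable_grad hlo.measurable θ₀
  have hvar := fun k (hk : k ∈ Finset.Icc 1 N) => lintegral_avgGrad_sub_le hprob hs
    hlo.measurable (Finset.mem_Icc.1 hk).1 (hmdK k hk)
  have hβ := fun k => stdParams_beta_pos (N := N) hL k
  have hgradm := measurable_gradient (objective P f)
  have hξ : Measurable fun ω => fun j => ξ j ω := measurable_pi_lambda _ hs.measurable_sample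
  -- From here on only the collected bounds and measurability facts matter, so the run is replaced
  -- by arbitrary functions of the samples.
  generalize (stdParams L N).β = β at *
  generalize mdPoint (stdParams L N) (stochGrad f) lo θ₀ = X at *
  generalize avgGrad (stdParams L N) (stochGrad f) lo θ₀ = A at *
  generalize gradient (objective P f) = g at *
  have hNpos : (0 : ℝ) < N := by exact_mod_cast hN
  have hcont := fun k => continuous_gradMap hne hKc hprob.convex (hβ k)
  have hXξ := fun k => (hmd k).comp hξ
  have hAξ := fun k => (havg k).comp hξ
  have hgX := fun k => hgradm.comp (hmd k)
  have hgXξ := fun k => (hgX k).comp hξ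
  have hQm : ∀ k, Measurable fun s => ‖gradMap K (X s k) (A s k) (β k)‖ ^ 2 := fun k =>
    (((hcont k).measurable.comp ((hmd k).prodMk (havg k))).norm).pow_const 2
  have hQm' : ∀ k, Measurable fun s => ‖gradMap K (X s k) (g (X s k)) (β k)‖ ^ 2 := fun k =>
    (((hcont k).measurable.comp ((hmd k).prodMk (hgX k))).norm).pow_const 2
  have hQ : ∀ k ∈ Finset.Icc 1 N, Integrable (fun ω => ‖gradMap K (X (fun j => ξ j ω) k)
      (A (fun j => ξ j ω) k) (β k)‖ ^ 2) μ := fun k hk =>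
    integrable_gradMap_sq hprob (hXξ k) (hAξ k) (fun ω => hmdK k hk _) (hβ k)
  have hQ' : ∀ k ∈ Finset.Icc 1 N, Integrable (fun ω => ‖gradMap K (X (fun j => ξ j ω) k)
      (g (X (fun j => ξ j ω) k)) (β k)‖ ^ 2) μ := fun k hk =>
    integrable_gradMap_sq hprob (hXξ k) (hgXξ k) (fun ω => hmdK k hk _) (hβ k)
  have hZ : ∀ k ∈ Finset.Icc 1 N, Integrable (fun ω => ‖A (fun j => ξ j ω) k
      - g (X (fun j => ξ j ω) k)‖ ^ 2) μ ∧
      ∫ ω, ‖A (fun j => ξ j ω) k - g (X (fun j => ξ j ω) k)‖ ^ 2 ∂μ ≤ σ ^ 2 / k := by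
    intro k hk
    have hm : Measurable fun ω => A (fun j => ξ j ω) k - g (X (fun j => ξ j ω) k) :=
      Measurable.sub (hAξ k) (hgXξ k)
    exact integrable_and_integral_norm_sq_le hm.aestronglyMeasurable (by positivity) (hvar k hk)
  -- The batch size `k` cancels one factor of the weight `k (k + 1) / 2`, leaving at most `N` per
  -- term.
  have hZsum : ∑ k ∈ Finset.Icc 1 N, (Gam k)⁻¹ * ∫ ω, ‖A (fun j => ξ j ω) k
      - g (X (fun j => ξ j ω) k)‖ ^ 2 ∂μ ≤ σ ^ 2 * N ^ 2 := by
    have hterm : ∀ k ∈ Finset.Icc 1 N, (Gam k)⁻¹ * ∫ ω, ‖A (fun j => ξ j ω) k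
        - g (X (fun j => ξ j ω) k)‖ ^ 2 ∂μ ≤ σ ^ 2 * N := by
      intro k hk
      obtain ⟨hk1, hkN⟩ := Finset.mem_Icc.1 hk
      have hk1' : (1 : ℝ) ≤ k := by exact_mod_cast hk1
      have hkN' : (k : ℝ) ≤ N := by exact_mod_cast hkN
      calc _ ≤ (Gam k)⁻¹ * (σ ^ 2 / k) := by
            refine mul_le_mul_of_nonneg_left (hZ k hk).2 ?_
            rw [inv_Gam]; positivity
        _ = σ ^ 2 * ((k + 1) / 2) := by rw [inv_Gam]; field_simp
        _ ≤ σ ^ 2 * N := mul_le_mul_of_nonneg_left (by linarith) (sq_nonneg σ)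
    refine (Finset.sum_le_sum hterm).trans (le_of_eq ?_)
    rw [Finset.sum_const, Nat.card_Icc, Nat.add_sub_cancel, nsmul_eq_mul]
    ring
  have hQsum : ∑ k ∈ Finset.Icc 1 N, (Gam k)⁻¹ * ∫ ω, ‖gradMap K (X (fun j => ξ j ω) k)
      (A (fun j => ξ j ω) k) (β k)‖ ^ 2 ∂μ ≤ rateConst L l σ M * N ^ 2 := by
    have h1 := integral_mono
      (integrable_finsetSum (Finset.Icc 1 N) fun k hk => (hQ k hk).const_mul (Gam k)⁻¹)
      ((integrable_const _).add ((integrable_finsetSum (Finset.Icc 1 N) fun k hk =>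
        (hZ k hk).1.const_mul (Gam k)⁻¹).const_mul (32 * (1 + L))))
      (fun ω => hsum fun j => ξ j ω)
    simp only [Pi.add_apply] at h1
    rw [integral_add (integrable_const _) ((integrable_finsetSum (Finset.Icc 1 N) fun k hk =>
        (hZ k hk).1.const_mul (Gam k)⁻¹).const_mul (32 * (1 + L))), integral_const,
      integral_const_mul (32 * (1 + L)),
      integral_finsetSum _ fun k hk => (hQ k hk).const_mul (Gam k)⁻¹,
      integral_finsetSum _ fun k hk => (hZ k hk).1.const_mul (Gam k)⁻¹] at h1
    simp only [integral_const_mul, probReal_univ, one_smul] at h1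
    have h2 := mul_le_mul_of_nonneg_left hZsum (show 0 ≤ 32 * (1 + L) by positivity)
    unfold rateConst
    linarith
  -- The gradient mapping is `1`-Lipschitz in its gradient argument, so passing to the exact
  -- gradient costs a factor `2` and twice the noise.
  have hQsum' : ∑ k ∈ Finset.Icc 1 N, (Gam k)⁻¹ * ∫ ω, ‖gradMap K (X (fun j => ξ j ω) k)
      (g (X (fun j => ξ j ω) k)) (β k)‖ ^ 2 ∂μ
      ≤ (2 * rateConst L l σ M + 2 * σ ^ 2) * N ^ 2 := by
    have hterm : ∀ k ∈ Finset.Icc 1 N, (Gam k)⁻¹ * ∫ ω, ‖gradMap K (X (fun j => ξ j ω) k)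
        (g (X (fun j => ξ j ω) k)) (β k)‖ ^ 2 ∂μ
        ≤ 2 * ((Gam k)⁻¹ * ∫ ω, ‖gradMap K (X (fun j => ξ j ω) k)
            (A (fun j => ξ j ω) k) (β k)‖ ^ 2 ∂μ)
          + 2 * ((Gam k)⁻¹ * ∫ ω, ‖A (fun j => ξ j ω) k - g (X (fun j => ξ j ω) k)‖ ^ 2 ∂μ) := by
      intro k hk
      have h1 := integral_mono (hQ' k hk) (((hQ k hk).const_mul 2).add
        ((hZ k hk).1.const_mul 2)) (fun ω => by
          have h := norm_gradMap_sub_le hne hKc hprob.convex (hβ k) (X (fun j => ξ j ω) k)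
            (A (fun j => ξ j ω) k) (g (X (fun j => ξ j ω) k))
          have h' := norm_le_norm_add_norm_sub (gradMap K (X (fun j => ξ j ω) k)
            (A (fun j => ξ j ω) k) (β k)) (gradMap K (X (fun j => ξ j ω) k)
            (g (X (fun j => ξ j ω) k)) (β k))
          have h2 := h'.trans (add_le_add_right h _)
          simp only [Pi.add_apply]
          refine (pow_le_pow_left₀ (norm_nonneg _) h2 2).trans ?_
          nlinarith [sq_nonneg (‖gradMap K (X (fun j => ξ j ω) k) (A (fun j => ξ j ω) k) (β k)‖
            - ‖A (fun j => ξ j ω) k - g (X (fun j => ξ j ω) k)‖)])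
      simp only [Pi.add_apply] at h1
      rw [integral_add ((hQ k hk).const_mul 2) ((hZ k hk).1.const_mul 2), integral_const_mul,
        integral_const_mul] at h1
      have hw : 0 ≤ (Gam k)⁻¹ := by rw [inv_Gam]; positivity
      have h2 := mul_le_mul_of_nonneg_left h1 hw
      linarith
    refine (Finset.sum_le_sum hterm).trans ?_
    rw [Finset.sum_add_distrib, ← Finset.mul_sum, ← Finset.mul_sum]
    linarith
  obtain ⟨h1, h2⟩ := hs.integral_comp_index hN
    (H := fun k s => ‖gradMap K (X s k) (A s k) (β k)‖ ^ 2) hQm hQ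
  obtain ⟨h3, h4⟩ := hs.integral_comp_index hN
    (H := fun k s => ‖gradMap K (X s k) (g (X s k)) (β k)‖ ^ 2) hQm' hQ'
  have hc := rateConst_nonneg hL l σ M
  refine ⟨⟨h1, ?_⟩, ⟨h3, ?_⟩⟩
  · rw [h2]
    exact sum_stopProb_mul_le hN hc hQsum
  · rw [h4]
    exact sum_stopProb_mul_le hN (by positivity) hQsum'

end Rate

end

end NCGS

end

/-! ### Choice of the horizon and of the complexity constant. -/

theorem corollary2 (L l σ M : ℝ) (hL : 0 < L) :
    ∃ C : ℝ, 0 < C ∧ ∀ ε : ℝ, 0 < ε → ε ≤ 1 → ∃ N : ℕ, 1 ≤ N ∧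
      ∀ {d : ℕ} {Ξ W : Type*} [MeasurableSpace Ξ] [MeasurableSpace W]
        (K : Set (NCGS.Vec d)) (P : Measure Ξ) [IsProbabilityMeasure P]
        (f : NCGS.Vec d → Ξ → ℝ) (lo : NCGS.Vec d → NCGS.Vec d) (θ₀ : NCGS.Vec d)
        (μ : Measure W) [IsProbabilityMeasure μ] (ξ : ℕ × ℕ → W → Ξ) (R : W → ℕ),
        NCGS.IsStochasticProblem L l σ M K P f → NCGS.IsLinearOracle K lo → θ₀ ∈ K →
        NCGS.IsSampling P μ ξ N R →
        let p := NCGS.stdParams L N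
        let G := NCGS.stochGrad f
        let md : W → NCGS.Vec d := fun ω => NCGS.mdPoint p G lo θ₀ (fun j => ξ j ω) (R ω)
        let Gbar : W → NCGS.Vec d := fun ω => NCGS.avgGrad p G lo θ₀ (fun j => ξ j ω) (R ω)
        let final : W → NCGS.State d := fun ω => NCGS.run p G lo θ₀ (fun j => ξ j ω) (R ω)
        (Integrable (fun ω => ‖NCGS.gradMap K (md ω) (Gbar ω) (p.β (R ω))‖ ^ 2) μ ∧
          ∫ ω, ‖NCGS.gradMap K (md ω) (Gbar ω) (p.β (R ω))‖ ^ 2 ∂μ ≤ ε) ∧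
        (Integrable (fun ω => ‖NCGS.gradMap K (md ω)
            (gradient (NCGS.objective P f) (md ω)) (p.β (R ω))‖ ^ 2) μ ∧
          ∫ ω, ‖NCGS.gradMap K (md ω)
            (gradient (NCGS.objective P f) (md ω)) (p.β (R ω))‖ ^ 2 ∂μ ≤ ε) ∧
        (∀ᵐ ω ∂μ, ((final ω).sfo : ℝ) ≤ C / ε ^ 2) ∧
        (∀ᵐ ω ∂μ, ∃ n : ℕ, (final ω).lo = n ∧ (n : ℝ) ≤ C / ε ^ 2) := by
  have hr := NCGS.rateConst_nonneg hL l σ M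
  set c : ℝ := 6 * (2 * NCGS.rateConst L l σ M + 2 * σ ^ 2) with hc
  have hc0 : 0 ≤ c := by positivity
  set B : ℝ := 4 * L * (4 * M ^ 2) + 1 with hB
  have hB1 : 1 ≤ B := by
    have : 0 ≤ 4 * L * (4 * M ^ 2) := by positivity
    linarith
  -- Each iteration makes two `condg` calls of at most `2 * S` oracle calls, with `S ≤ (2 * B + 1) *
  -- N`; finally `N ≤ (c + 2) / ε`. The first-order calls fit in the same constant.
  refine ⟨4 * (2 * B + 1) * (c + 2) ^ 2, by positivity, fun ε hε hε1 => ?_⟩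
  -- The `+ 1` keeps `N ≥ 1` when `c = 0`. Rounding up and this `+ 1` cost at most `2 ≤ 2 / ε`,
  -- which is where `ε ≤ 1` enters. The constant `c`, made for the exact gradient, also covers the
  -- first bound.
  obtain ⟨N, hN⟩ : ∃ N : ℕ, N = ⌈c / ε⌉₊ + 1 := ⟨_, rfl⟩
  have hN1 : 1 ≤ N := by omega
  have hN1' : (1 : ℝ) ≤ N := by exact_mod_cast hN1
  have hNpos : (0 : ℝ) < N := by linarith
  have hNge : c / N ≤ ε := by
    rw [div_le_iff₀ hNpos, ← div_le_iff₀' hε]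
    refine (Nat.le_ceil _).trans ?_
    exact_mod_cast (by omega : ⌈c / ε⌉₊ ≤ N)
  have hNle : (N : ℝ) ≤ (c + 2) / ε := by
    have h1 := (Nat.ceil_lt_add_one (div_nonneg hc0 hε.le)).le
    have h2 : 1 ≤ 1 / ε := by rw [le_div_iff₀ hε]; linarith
    have e : (c + 2) / ε = c / ε + 1 / ε + 1 / ε := by ring
    rw [hN, e]
    push_cast
    linarith
  have hNsq : (N : ℝ) * N ≤ (c + 2) ^ 2 / ε ^ 2 := by
    rw [← div_pow, ← sq]
    gcongr
  refine ⟨N, hN1, ?_⟩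
  intro d Ξ W _ _ K P _ f lo θ₀ μ _ ξ R hprob hlo hθ₀ hs p G md Gbar final
  obtain ⟨⟨h1, h2⟩, ⟨h3, h4⟩⟩ := NCGS.expected_gradMap_sq_le hL hN1 hprob hlo hθ₀ hs
  refine ⟨⟨h1, h2.trans (le_trans ?_ hNge)⟩, ⟨h3, h4.trans hNge⟩, ?_, ?_⟩
  · rw [hc]
    gcongr
    nlinarith [sq_nonneg σ]
  · filter_upwards [hs.index_mem hN1] with ω hω
    have hRN := (Finset.mem_Icc.1 hω).2
    have h := NCGS.run_sfo_le (L := L) (lo := lo) (θ₀ := θ₀) G (fun j => ξ j ω) hRN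
    have hRN' : (R ω : ℝ) ≤ N := by exact_mod_cast hRN
    calc ((final ω).sfo : ℝ) ≤ R ω * N := h
      _ ≤ N * N := by gcongr
      _ ≤ (c + 2) ^ 2 / ε ^ 2 := hNsq
      _ ≤ 4 * (2 * B + 1) * (c + 2) ^ 2 / ε ^ 2 := by
        gcongr
        exact le_mul_of_one_le_left (by positivity) (by linarith)
  · filter_upwards [hs.index_mem hN1] with ω hω
    have hRN := (Finset.mem_Icc.1 hω).2
    have hRN' : (R ω : ℝ) ≤ N := by exact_mod_cast hRN
    -- This `S` is the least natural number strictly above `2 * B / η` with `η = 1 / N`, as the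
    -- complexity bound requires.
    have h := NCGS.run_lo_le hprob.convex hlo hL hN1 hprob.norm_sub_sq_le hθ₀ G
      (fun j => ξ j ω) (S := ⌊2 * B / (1 / (N : ℝ))⌋₊ + 1)
      (by push_cast; exact Nat.lt_floor_add_one _) (R ω)
    obtain ⟨n, hn⟩ := ENat.ne_top_iff_exists.1 (ne_top_of_le_ne_top (ENat.natCast_ne_top _) h)
    refine ⟨n, hn.symm, ?_⟩
    rw [← hn, Nat.cast_le] at h
    have hfl := Nat.floor_le (show 0 ≤ 2 * B / (1 / (N : ℝ)) by positivity)
    have e : 2 * B / (1 / (N : ℝ)) = 2 * B * N := by rw [div_div_eq_mul_div, div_one]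
    calc (n : ℝ) ≤ ((R ω * (4 * (⌊2 * B / (1 / (N : ℝ))⌋₊ + 1)) : ℕ) : ℝ) := by
          exact_mod_cast h
      _ = R ω * (4 * (⌊2 * B / (1 / (N : ℝ))⌋₊ + 1)) := by push_cast; ring
      _ ≤ N * (4 * ((2 * B + 1) * N)) := by
        gcongr
        rw [e] at hfl ⊢
        linarith
      _ = 4 * (2 * B + 1) * (N * N) := by ring
      _ ≤ 4 * (2 * B + 1) * ((c + 2) ^ 2 / ε ^ 2) := by gcongr
      _ = 4 * (2 * B + 1) * (c + 2) ^ 2 / ε ^ 2 := by ring
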